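/- Let $M$ be a connected oriented smooth surface, let $h$ be a smooth Riemannian metric on $M$ with scalar curvature $R$ (twice the Gauss curvature) and Laplacian $\Delta f = \mathrm{tr}_h\, D\,df$, where $D$ is the Levi-Civita connection, and let $Y$ be a smooth vector field on $M$. Let $\varepsilon \in \{1,-1\}$ and suppose that $(h,Y)$ solves the real vortex equations $$d\big(R + 4\varepsilon |Y|_h^2\big) = 0, \qquad \mathcal{L}_Y h = 0,$$ and let $\tau$ be the constant value of $R + 4\varepsilon|Y|_h^2$. Let $J$ be the complex structure determined by $h$ and the orientation, $\omega(\cdot,\cdot) = h(J\cdot,\cdot)$, and $\star\alpha = -\alpha\circ J$ for one-forms $\alpha$. Put $\gamma = h(Y,\cdot)$ and define the Faraday function $F : M \to \mathbb{R}$ by $-2\,d\gamma = F\omega$. Let $\mu$ be a moment map, that is, a primitive of (the pullback of) $-\star\gamma$ on the universal cover $\tilde M$ of $M$; functions on $M$ are also regarded as functions on $\tilde M$. Let $\lambda = 1$ if $\varepsilon = 1$ and $\lambda = \sqrt{-1}$ if $\varepsilon = -1$. Then $R$ and $F$ are smooth and the following hold. 1. $\sigma = R^2 - \varepsilon F^2$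 is constant on $M$, and each of the functions $e^{-2\lambda\mu}(R + \lambda F)$ and $e^{2\lambda\mu}(R - \lambda F)$ is constant on $\tilde M$. 2. If $\varepsilon = 1$ and at least one of $R + F$, $R - F$ is not identically zero, then $\mu$ descends to a function on $M$ (a smooth primitive of $-\star\gamma$ on $M$). If $\varepsilon = 1$, then each of $R + F$ and $R - F$ that is not identically zero is everywhere positive or everywhere negative. 3. If $\varepsilon = 1$, then $R \le \tau$, with equality exactly where $Y$ vanishes, and $R^2 \ge \sigma$, with equality exactly where $F$ vanishes. In particular: (a) if $\sigma > 0$, then $R$ is everywhere positive or everywhere negative, and either $\sqrt{\sigma} \le R \le \tau$ on $M$, or $R \le \min\{\tau, -\sqrt{\sigma}\} < 0$ on $M$; (b) if $\sigma < 0$, then $F$ is everywhere positive or everywhere negative. 4. If $\varepsilon = -1$, then $\sigma \ge 0$; $-\sqrt{\sigma} \le R \le \sqrt{\sigma}$, with one of the inequalities an equality exactly where $F$ vanishes; $-\sqrt{\sigma} \le F \le \sqrt{\sigma}$, with one of the inequalities an equality exactly where $R$ vanishes; and $R \ge \tau$, with equality exactly where $Y$ vanishes. 5. A critical point of $R$ is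 a zero of $F$ or a zero of $Y$; in the latter case it is also a critical point of $F$. A critical point of $F$ is a zero of $R$ or a zero of $Y$; in the latter case it is also a critical point of $R$. 6. $\Delta R + 2R^2 = \tau R + \sigma$ and $\Delta F = \tau F - 2RF$. 7. If $\sigma \ne 0$, then the set $\{p \in M : Y(p) \ne 0,\ F(p) = 0\}$ is a union of images of maximal integral curves of $Y$, each of which is an $h$-geodesic whose image is a closed subset of $M$. -/

import Mathlib

open scoped Manifold ContDiff Topology
open Bundle

noncomputable section

/-! ### Surfaces with a Riemannian metric

A surface is a manifold `M` modelled on the Euclidean plane.  A Riemannian metric `h` on it is given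
by Mathlib's `RiemannianBundle` structure on the tangent bundle, so that `h(v, w)` is `inner ℝ v w`
and `|v|_h` is `‖v‖`. -/

/-- The Euclidean plane, on which surfaces are modelled. -/
abbrev Plane : Type := EuclideanSpace ℝ (Fin 2)

section Metric

variable {M : Type*} [TopologicalSpace M] [ChartedSpace Plane M] [IsManifold (𝓡 2) ∞ M]
  [RiemannianBundle (fun x : M => TangentSpace (𝓡 2) x)]

instance tangentFinrankFact (x : M) : Fact (Module.finrank ℝ (TangentSpace (𝓡 2) x) = 2) :=
  ⟨(finrank_euclideanSpace_fin : Module.finrank ℝ Plane = 2)⟩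

instance tangentFiniteDimensional (x : M) : FiniteDimensional ℝ (TangentSpace (𝓡 2) x) :=
  inferInstanceAs (FiniteDimensional ℝ Plane)

/-- An `h`-orthonormal basis of the tangent space at `x`; it is used only to take traces. -/
def onb (x : M) : OrthonormalBasis (Fin 2) ℝ (TangentSpace (𝓡 2) x) :=
  (stdOrthonormalBasis ℝ (TangentSpace (𝓡 2) x)).reindex
    (finCongr (finrank_euclideanSpace_fin : Module.finrank ℝ Plane = 2))

/-- An extension of a tangent vector `v` at `x` to a vector field that is smooth near `x` (constant
in the preferred chart at `x`).  The tensors below are evaluated on tangent vectors by extending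
these to vector fields; the values do not depend on the extension. -/
def extField {x : M} (v : TangentSpace (𝓡 2) x) : (y : M) → TangentSpace (𝓡 2) y :=
  FiberBundle.extend Plane v

/-- `Y` is a smooth vector field. -/
def IsSmoothField (Y : (x : M) → TangentSpace (𝓡 2) x) : Prop :=
  ContMDiff (𝓡 2) ((𝓡 2).prod 𝓘(ℝ, Plane)) ∞
    (fun x => TotalSpace.mk' Plane (E := (TangentSpace (𝓡 2) : M → Type _)) x (Y x))

/-- `Y` is smooth at `x`. -/
def IsSmoothFieldAt (Y : (x : M) → TangentSpace (𝓡 2) x) (x : M) : Prop :=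
  ContMDiffAt (𝓡 2) ((𝓡 2).prod 𝓘(ℝ, Plane)) ∞
    (fun x => TotalSpace.mk' Plane (E := (TangentSpace (𝓡 2) : M → Type _)) x (Y x)) x

/-- `koszul X Y Z x` is `h(D_X Y, Z)` at `x`, according to the Koszul formula
`2 h(D_X Y, Z) = X h(Y, Z) + Y h(X, Z) - Z h(X, Y) + h([X, Y], Z) - h([X, Z], Y) - h([Y, Z], X)`. -/
def koszul (X Y Z : (x : M) → TangentSpace (𝓡 2) x) (x : M) : ℝ :=
  (mvfderiv (𝓡 2) (fun y => inner ℝ (Y y) (Z y)) x (X x)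
    + mvfderiv (𝓡 2) (fun y => inner ℝ (X y) (Z y)) x (Y x)
    - mvfderiv (𝓡 2) (fun y => inner ℝ (X y) (Y y)) x (Z x)
    + inner ℝ (VectorField.mlieBracket (𝓡 2) X Y x) (Z x)
    - inner ℝ (VectorField.mlieBracket (𝓡 2) X Z x) (Y x)
    - inner ℝ (VectorField.mlieBracket (𝓡 2) Y Z x) (X x)) / 2

/-- The Levi-Civita connection `D` of `h`: `leviCivita Y x v` is `D_v Y`. -/
def leviCivita (Y : (x : M) → TangentSpace (𝓡 2) x) (x : M) (v : TangentSpace (𝓡 2) x) :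
    TangentSpace (𝓡 2) x :=
  ∑ i, koszul (extField v) Y (extField (onb x i)) x • onb x i

/-- The curvature tensor `R(u, v) w = D_u D_v w - D_v D_u w - D_[u, v] w` of `D`. -/
def curvature (x : M) (u v w : TangentSpace (𝓡 2) x) : TangentSpace (𝓡 2) x :=
  leviCivita (fun y => leviCivita (extField w) y (extField v y)) x u
    - leviCivita (fun y => leviCivita (extField w) y (extField u y)) x v
    - leviCivita (extField w) x (VectorField.mlieBracket (𝓡 2) (extField u) (extField v) x)

/-- The scalar curvature (twice the Gauss curvature). -/
def scalarCurvature (x : M) : ℝ :=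
  ∑ i, ∑ j, inner ℝ (curvature x (onb x i) (onb x j) (onb x j)) (onb x i)

/-- The gradient of a function. -/
def grad (f : M → ℝ) (x : M) : TangentSpace (𝓡 2) x :=
  ∑ i, mvfderiv (𝓡 2) f x (onb x i) • onb x i

/-- The Laplacian of a function: the trace of `D grad f`, equivalently of the Hessian `D df`. -/
def laplacian (f : M → ℝ) (x : M) : ℝ :=
  ∑ i, inner ℝ (leviCivita (grad f) x (onb x i)) (onb x i)

/-- The Lie derivative of the metric along `Y`:
`(L_Y h)(v, w) = Y h(v, w) - h([Y, v], w) - h(v, [Y, w])`. -/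
def lieDerivMetric (Y : (x : M) → TangentSpace (𝓡 2) x) (x : M) (v w : TangentSpace (𝓡 2) x) : ℝ :=
  mvfderiv (𝓡 2) (fun y => inner ℝ (extField v y) (extField w y)) x (Y x)
    - inner ℝ (VectorField.mlieBracket (𝓡 2) Y (extField v) x) w
    - inner ℝ v (VectorField.mlieBracket (𝓡 2) Y (extField w) x)

/-- `(h, Y)` solves the real vortex equations with parameter `ε`:
`d(R + 4 ε |Y|²) = 0` and `L_Y h = 0`. -/
structure SolvesRealVortex (ε : ℝ) (Y : (x : M) → TangentSpace (𝓡 2) x) : Prop where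
  smooth : IsSmoothField Y
  killing : ∀ (x : M) (v w : TangentSpace (𝓡 2) x), lieDerivMetric Y x v w = 0
  vortex : ∀ x : M, mvfderiv (𝓡 2) (fun y : M => scalarCurvature y + 4 * ε * ‖Y y‖ ^ 2) x = 0

/-- The one-form `γ` that is `h`-dual to `Y`. -/
def dualForm (Y : (x : M) → TangentSpace (𝓡 2) x) (x : M) : TangentSpace (𝓡 2) x →L[ℝ] ℝ :=
  innerSL ℝ (Y x)

/-- The exterior derivative of a one-form: `dα(v, w) = v(α(w)) - w(α(v)) - α([v, w])`. -/
def extDerivForm (α : (x : M) → TangentSpace (𝓡 2) x →L[ℝ] ℝ) (x : M)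
    (v w : TangentSpace (𝓡 2) x) : ℝ :=
  mvfderiv (𝓡 2) (fun y => α y (extField w y)) x v - mvfderiv (𝓡 2) (fun y => α y (extField v y)) x w
    - α x (VectorField.mlieBracket (𝓡 2) (extField v) (extField w) x)

/-! ### Orientation -/

/-- A family of orientations of the tangent spaces is an orientation of the surface if near every
point there is a smooth positively oriented local frame. -/
def IsSurfaceOrientation (o : (x : M) → Orientation ℝ (TangentSpace (𝓡 2) x) (Fin 2)) : Prop :=
  ∀ x₀ : M, ∃ X : Fin 2 → (x : M) → TangentSpace (𝓡 2) x,
    (∀ i, IsSmoothFieldAt (X i) x₀) ∧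
    ∀ᶠ x in 𝓝 x₀, ∃ b : Module.Basis (Fin 2) ℝ (TangentSpace (𝓡 2) x),
      (∀ i, b i = X i x) ∧ b.orientation = o x

variable (o : (x : M) → Orientation ℝ (TangentSpace (𝓡 2) x) (Fin 2))

/-- The complex structure `J` determined by `h` and the orientation: rotation by a right angle. -/
def cplx (x : M) : TangentSpace (𝓡 2) x →L[ℝ] TangentSpace (𝓡 2) x :=
  ((o x).rightAngleRotation.toContinuousLinearEquiv :
    TangentSpace (𝓡 2) x →L[ℝ] TangentSpace (𝓡 2) x)

/-- The Hodge star on one-forms, `⋆α = -α ∘ J`. -/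
def hodge (α : (x : M) → TangentSpace (𝓡 2) x →L[ℝ] ℝ) (x : M) : TangentSpace (𝓡 2) x →L[ℝ] ℝ :=
  -((α x).comp (cplx o x))

/-- The Faraday function of `(h, Y)`.  With `F = -dγ` and `ω(v, w) = h(J v, w)` it is defined by
`2 F = 𝔉 ω`; as `ω(e, J e) = 1` for unit vectors `e`, this means that `𝔉` is the sum of the
`F(e, J e)` over an orthonormal basis. -/
def faraday (Y : (x : M) → TangentSpace (𝓡 2) x) (x : M) : ℝ :=
  ∑ i, -(extDerivForm (dualForm Y) x (onb x i) (cplx o x (onb x i)))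

/-- `m` is a smooth primitive of `-⋆γ` on `M`. -/
def IsMomentMap (Y : (x : M) → TangentSpace (𝓡 2) x) (m : M → ℝ) : Prop :=
  ContMDiff (𝓡 2) 𝓘(ℝ, ℝ) ∞ m ∧ ∀ x : M, mvfderiv (𝓡 2) m x = -(hodge o (dualForm Y) x)

/-- `μ` is a smooth primitive of the pullback of `-⋆γ` by `pr`. -/
def IsMomentMapAlong {N : Type*} [TopologicalSpace N] [ChartedSpace Plane N] (pr : N → M)
    (Y : (x : M) → TangentSpace (𝓡 2) x) (μ : N → ℝ) : Prop :=
  ContMDiff (𝓡 2) 𝓘(ℝ, ℝ) ∞ μ ∧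
    ∀ x : N, mvfderiv (𝓡 2) μ x = (-(hodge o (dualForm Y) (pr x))).comp (mfderiv (𝓡 2) (𝓡 2) pr x)

end Metric

/-- `pr : N → M` is the universal cover of the surface `M`: a covering map from a simply connected
surface that is a local diffeomorphism. -/
structure IsUniversalCover {M N : Type*} [TopologicalSpace M] [ChartedSpace Plane M]
    [TopologicalSpace N] [ChartedSpace Plane N] (pr : N → M) : Prop where
  isManifold : IsManifold (𝓡 2) ∞ N
  simplyConnected : SimplyConnectedSpace N
  covering : IsCoveringMap pr
  localDiffeo : IsLocalDiffeomorph (𝓡 2) (𝓡 2) ∞ pr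

section Curves

variable {M : Type*} [TopologicalSpace M] [ChartedSpace Plane M] [IsManifold (𝓡 2) ∞ M]

/-- `ν` is an integral curve of `Y` on the nonempty open interval `s`. -/
def IsIntegralCurveOnInterval (ν : ℝ → M) (Y : (x : M) → TangentSpace (𝓡 2) x) (s : Set ℝ) : Prop :=
  IsOpen s ∧ s.OrdConnected ∧ s.Nonempty ∧ IsMIntegralCurveOn ν Y s

/-- `ν` is a maximal integral curve of `Y`, with domain the open interval `s`. -/
def IsMaximalIntegralCurve (ν : ℝ → M) (Y : (x : M) → TangentSpace (𝓡 2) x) (s : Set ℝ) : Prop :=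
  IsIntegralCurveOnInterval ν Y s ∧
    ∀ (ν' : ℝ → M) (s' : Set ℝ), IsIntegralCurveOnInterval ν' Y s' → s ⊆ s' → Set.EqOn ν' ν s →
      s' = s

variable [RiemannianBundle (fun x : M => TangentSpace (𝓡 2) x)]

/-- `ν` is an `h`-geodesic on the open set `s`: near each time in `s` its velocity extends to a
smooth local vector field `V`, and there `D_ν' ν' = D_V V` vanishes along `ν`. -/
def IsGeodesicOn (ν : ℝ → M) (s : Set ℝ) : Prop :=
  ∀ t ∈ s, ∃ V : (x : M) → TangentSpace (𝓡 2) x, IsSmoothFieldAt V (ν t) ∧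
    IsMIntegralCurveAt ν V t ∧ leviCivita V (ν t) (V (ν t)) = 0

end Curves

/-- `f` is everywhere positive or everywhere negative. -/
def HasDefiniteSign {M : Type*} (f : M → ℝ) : Prop :=
  (∀ x, 0 < f x) ∨ (∀ x, f x < 0)

end

/-! On an oriented surface the equations reduce to a linear first-order system. By the Killing
equation $DY$ is skew, so $D_vY = -\tfrac14 F\,Jv$ (`leviCivita_eq_of_killing`). Differentiating
$|Y|^2$ and using $R = \tau - 4\varepsilon|Y|^2$ gives $dR = 2\varepsilon F\,h(Y, J\cdot)$.
Differentiating $DY$ once more and comparing with the curvature acting on $Y$ gives $dF = 2R\,h(Y,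
J\cdot)$ (`mvfderiv_faraday`). Here $h(Y, J\cdot) = -\star\gamma$, which becomes $d\mu$ on the
universal cover.

Most claims can be read off from this system. The form $2R\,dR - 2\varepsilon F\,dF$ vanishes, so
$\sigma$ is constant. Since $\lambda^2 = \varepsilon$, $d(R \pm \lambda F) = \pm 2\lambda (R \pm
\lambda F)\,d\mu$, which gives the exponential formulas. For $\varepsilon = 1$ this is a real linear
equation on $M$ itself, so a solution with one zero vanishes identically
(`eq_zero_of_abs_mvfderiv_le`). A solution that is not identically zero has a sign, and its
logarithm is the descended moment map. The bounds follow from $R^2 = \sigma + \varepsilon F^2$ and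
$R = \tau - 4\varepsilon|Y|^2$, and the critical points from evaluating $dR$ and $dF$ on $JY$. The
Laplacians follow because each gradient is a multiple of $JY$ and $J$ is parallel
(`laplacian_eq_of_killing`).

For the zero set of $F$, both $F$ and $|Y|^2$ are constant along $Y$, so the set is a union of
integral curves, and $D_YY = -\tfrac14 F\,JY = 0$ on it. If $\sigma \neq 0$, then $R \neq 0$ there,
so $F$ is regular where $Y \neq 0$. Near a limit point of such a curve, the zero set of $F$ lies in
the single integral curve through that point. The two curves meet, so maximality puts the limit
point on the original curve (`IsMaximalIntegralCurve.isClosed_image`).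

The groundwork is to recover from the Koszul formula that $D$ is metric and torsion-free, and to
compute the curvature from the connection form of an oriented orthonormal frame
(`curvature_eq_smul_cplx`). -/

set_option linter.unusedSectionVars false

/-! ### Fields and functions that are smooth near a point -/

section Calculus

variable {M : Type*} [TopologicalSpace M] [ChartedSpace Plane M] [IsManifold (𝓡 2) ∞ M]

/-- `W` is a smooth vector field on a neighbourhood of `x`. -/
def SmoothFieldNear (W : (x : M) → TangentSpace (𝓡 2) x) (x : M) : Prop :=
  ∀ᶠ y in 𝓝 x, IsSmoothFieldAt W y

/-- `f` is a smooth function on a neighbourhood of `x`. -/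
def SmoothFunNear (f : M → ℝ) (x : M) : Prop :=
  ∀ᶠ y in 𝓝 x, ContMDiffAt (𝓡 2) 𝓘(ℝ, ℝ) ∞ f y

/-- `W` is differentiable at `x` as a section of the tangent bundle. -/
abbrev DiffFieldAt (W : (x : M) → TangentSpace (𝓡 2) x) (x : M) : Prop :=
  MDifferentiableAt (𝓡 2) ((𝓡 2).prod 𝓘(ℝ, Plane))
    (fun y => TotalSpace.mk' Plane (E := (TangentSpace (𝓡 2) : M → Type _)) y (W y)) x

/-- `f` is differentiable at `x`. -/
abbrev DiffFunAt (f : M → ℝ) (x : M) : Prop := MDifferentiableAt (𝓡 2) 𝓘(ℝ, ℝ) f x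

variable {V W X Y Z : (x : M) → TangentSpace (𝓡 2) x} {f g : M → ℝ} {x : M}

theorem SmoothFieldNear.eventually (h : SmoothFieldNear W x) :
    ∀ᶠ y in 𝓝 x, SmoothFieldNear W y := eventually_eventually_nhds.2 h

theorem SmoothFunNear.eventually (h : SmoothFunNear f x) :
    ∀ᶠ y in 𝓝 x, SmoothFunNear f y := eventually_eventually_nhds.2 h

theorem IsSmoothFieldAt.diff (h : IsSmoothFieldAt W x) : DiffFieldAt W x :=
  ContMDiffAt.mdifferentiableAt h (by simp)

theorem SmoothFieldNear.smooth (h : SmoothFieldNear W x) : IsSmoothFieldAt W x := h.self_of_nhds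

theorem SmoothFieldNear.diff (h : SmoothFieldNear W x) : DiffFieldAt W x := h.smooth.diff

theorem SmoothFunNear.smooth (h : SmoothFunNear f x) :
    ContMDiffAt (𝓡 2) 𝓘(ℝ, ℝ) ∞ f x := h.self_of_nhds

theorem SmoothFunNear.diff (h : SmoothFunNear f x) : DiffFunAt f x :=
  h.smooth.mdifferentiableAt (by simp)

theorem SmoothFunNear.congr (h : SmoothFunNear f x) (hg : g =ᶠ[𝓝 x] f) : SmoothFunNear g x := by
  filter_upwards [h, hg.eventuallyEq_nhds] with y hy hy' using hy.congr_of_eventuallyEq hy'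

theorem SmoothFieldNear.congr (h : SmoothFieldNear W x) (hV : V =ᶠ[𝓝 x] W) :
    SmoothFieldNear V x := by
  filter_upwards [h, hV.eventuallyEq_nhds] with y hy hy'
  exact ContMDiffAt.congr_of_eventuallyEq hy (hy'.mono fun z hz => by simp [hz])

theorem SmoothFunNear.add (hf : SmoothFunNear f x) (hg : SmoothFunNear g x) :
    SmoothFunNear (fun y => f y + g y) x := by
  filter_upwards [hf, hg] with y h1 h2 using h1.add h2

theorem SmoothFunNear.sub (hf : SmoothFunNear f x) (hg : SmoothFunNear g x) :
    SmoothFunNear (fun y => f y - g y) x := by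
  filter_upwards [hf, hg] with y h1 h2 using h1.sub h2

theorem SmoothFunNear.mul (hf : SmoothFunNear f x) (hg : SmoothFunNear g x) :
    SmoothFunNear (fun y => f y * g y) x := by
  filter_upwards [hf, hg] with y h1 h2 using h1.mul h2

theorem SmoothFieldNear.smul (hf : SmoothFunNear f x) (hW : SmoothFieldNear W x) :
    SmoothFieldNear (f • W) x := by
  filter_upwards [hf, hW] with y h1 h2 using h1.smul_section h2

theorem SmoothFieldNear.add (hV : SmoothFieldNear V x) (hW : SmoothFieldNear W x) :
    SmoothFieldNear (V + W) x := by
  filter_upwards [hV, hW] with y h1 h2 using ContMDiffAt.add_section h1 h2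

theorem SmoothFieldNear.bracket (hV : SmoothFieldNear V x) (hW : SmoothFieldNear W x) :
    SmoothFieldNear (VectorField.mlieBracket (𝓡 2) V W) x := by
  filter_upwards [hV, hW] with y h1 h2
  have : IsManifold (𝓡 2) (((⊤ : ℕ∞) : WithTop ℕ∞) + 1) M := inferInstanceAs (IsManifold (𝓡 2) ∞ M)
  have : IsManifold (𝓡 2) (minSmoothness ℝ 2) M := by
    rw [minSmoothness_of_isRCLikeNormedField]; infer_instance
  have : IsManifold (𝓡 2) (minSmoothness ℝ 3) M := by
    rw [minSmoothness_of_isRCLikeNormedField]; infer_instance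
  exact ContMDiffAt.mlieBracket_vectorField (m := ⊤) (n := ⊤) h1 h2 (by simp)

theorem smoothFieldNear_extField (v : TangentSpace (𝓡 2) x) : SmoothFieldNear (extField v) x := by
  obtain ⟨s, hs, h⟩ := FiberBundle.exists_contMDiffOn_extend (k := ∞) (𝓡 2) Plane
    (V := (TangentSpace (𝓡 2) : M → Type _)) v
  filter_upwards [eventually_mem_nhds_iff.2 hs] with y hy
  exact (h y (mem_of_mem_nhds hy)).contMDiffAt hy

@[simp] theorem extField_self (v : TangentSpace (𝓡 2) x) : extField v x = v := by
  simp [extField]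

theorem diffFieldAt_extField (v : TangentSpace (𝓡 2) x) : DiffFieldAt (extField v) x :=
  (smoothFieldNear_extField v).diff

theorem mvfderiv_congr (h : f =ᶠ[𝓝 x] g) : mvfderiv (𝓡 2) f x = mvfderiv (𝓡 2) g x := by
  ext v
  simp only [mvfderiv, h.mfderiv_eq]
  rfl

/-- The derivative of a smooth function along a smooth field is smooth. -/
theorem SmoothFunNear.deriv (hf : SmoothFunNear f x) (hW : SmoothFieldNear W x) :
    SmoothFunNear (fun y => mvfderiv (𝓡 2) f y (W y)) x := by
  filter_upwards [hf, hW] with y h1 h2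
  have h3 : ContMDiffAt (𝓡 2) (𝓘(ℝ, ℝ).prod 𝓘(ℝ, ℝ)) ∞
      (fun z => (TotalSpace.mk' ℝ (f z) (mfderiv (𝓡 2) 𝓘(ℝ, ℝ) f z (W z)) :
        TangentBundle 𝓘(ℝ, ℝ) ℝ)) y :=
    ContMDiffAt.clm_apply_of_inCoordinates (h1.mfderiv_const (by simp)) h2 h1
  exact (contMDiff_snd_tangentBundle_modelSpace ℝ 𝓘(ℝ, ℝ)).contMDiffAt.comp y h3

/-- The Lie bracket is the commutator of derivations. -/
theorem mvfderiv_mlieBracket (hf : SmoothFunNear f x) (hX : SmoothFieldNear X x)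
    (hZ : SmoothFieldNear Z x) :
    mvfderiv (𝓡 2) f x (VectorField.mlieBracket (𝓡 2) X Z x) =
      mvfderiv (𝓡 2) (fun y => mvfderiv (𝓡 2) f y (Z y)) x (X x) -
        mvfderiv (𝓡 2) (fun y => mvfderiv (𝓡 2) f y (X y)) x (Z x) := by
  -- The formula is extracted from the Jacobi identity. Applied to `X`, `Z`, `f • W` and to `X`,
  -- `Z`, `W`, it leaves the desired difference times `W x`, so a field `W` with `W x ≠ 0` suffices.
  obtain ⟨w, hw⟩ : ∃ w : TangentSpace (𝓡 2) x, w ≠ 0 := exists_ne (α := Plane) 0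
  set W := extField w with hWd
  have hW : SmoothFieldNear W x := smoothFieldNear_extField w
  have key : ∀ {U T : (x : M) → TangentSpace (𝓡 2) x}, SmoothFieldNear U x → SmoothFieldNear T x →
      VectorField.mlieBracket (𝓡 2) U (VectorField.mlieBracket (𝓡 2) T (f • W)) x =
        mvfderiv (𝓡 2) (fun y => mvfderiv (𝓡 2) f y (T y)) x (U x) • W x
        + mvfderiv (𝓡 2) f x (T x) • VectorField.mlieBracket (𝓡 2) U W x
        + mvfderiv (𝓡 2) f x (U x) • VectorField.mlieBracket (𝓡 2) T W x
        + f x • VectorField.mlieBracket (𝓡 2) U (VectorField.mlieBracket (𝓡 2) T W) x := by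
    intro U T hU hT
    have e : VectorField.mlieBracket (𝓡 2) T (f • W) =ᶠ[𝓝 x]
        (fun y => mvfderiv (𝓡 2) f y (T y)) • W + f • VectorField.mlieBracket (𝓡 2) T W := by
      filter_upwards [hf.eventually, hW.eventually] with y h1 h2
      exact VectorField.mlieBracket_smul_right h1.diff h2.diff
    refine (Filter.EventuallyEq.mlieBracket_vectorField_eq (Filter.EventuallyEq.refl _ _) e).trans ?_
    rw [VectorField.mlieBracket_add_right, VectorField.mlieBracket_smul_right,
      VectorField.mlieBracket_smul_right]
    · abel
    · exact hf.diff
    · exact (hT.bracket hW).diff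
    · exact (hf.deriv hT).diff
    · exact hW.diff
    · exact (SmoothFieldNear.smul (hf.deriv hT) hW).diff
    · exact (SmoothFieldNear.smul hf (hT.bracket hW)).diff
  have s2 : ∀ {T : (x : M) → TangentSpace (𝓡 2) x}, SmoothFieldNear T x →
      ContMDiffAt (𝓡 2) ((𝓡 2).prod 𝓘(ℝ, Plane)) (minSmoothness ℝ 2)
    (fun y => TotalSpace.mk' Plane (E := (TangentSpace (𝓡 2) : M → Type _)) y (T y)) x :=
    fun h => ContMDiffAt.of_le h.smooth (by
      rw [minSmoothness_of_isRCLikeNormedField]; exact ENat.LEInfty.out)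
  have : IsManifold (𝓡 2) (minSmoothness ℝ 3) M := by
    rw [minSmoothness_of_isRCLikeNormedField]; infer_instance
  have J1 := VectorField.leibniz_identity_mlieBracket_apply (I := 𝓡 2) (s2 hX) (s2 hZ)
    (s2 (SmoothFieldNear.smul hf hW))
  have J2 := VectorField.leibniz_identity_mlieBracket_apply (I := 𝓡 2) (s2 hX) (s2 hZ) (s2 hW)
  rw [key hX hZ, key hZ hX, VectorField.mlieBracket_smul_right hf.diff hW.diff, J2] at J1
  have h0 : (mvfderiv (𝓡 2) f x (VectorField.mlieBracket (𝓡 2) X Z x) -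
      (mvfderiv (𝓡 2) (fun y => mvfderiv (𝓡 2) f y (Z y)) x (X x) -
        mvfderiv (𝓡 2) (fun y => mvfderiv (𝓡 2) f y (X y)) x (Z x))) • W x = 0 := by
    rw [smul_add] at J1
    linear_combination (norm := module) -J1
  rcases smul_eq_zero.1 h0 with h | h
  · linarith
  · exact absurd ((extField_self w).symm.trans h) hw

end Calculus

/-! ### The Levi-Civita connection -/

section Connection

variable {M : Type*} [TopologicalSpace M] [ChartedSpace Plane M] [IsManifold (𝓡 2) ∞ M]
  [RiemannianBundle (fun x : M => TangentSpace (𝓡 2) x)]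
  [IsContMDiffRiemannianBundle (𝓡 2) ∞ Plane (fun x : M => TangentSpace (𝓡 2) x)]
  {V W X Y Z : (x : M) → TangentSpace (𝓡 2) x} {f g : M → ℝ} {x : M}

theorem DiffFieldAt.inner (hV : DiffFieldAt V x) (hW : DiffFieldAt W x) :
    DiffFunAt (fun y => inner ℝ (V y) (W y)) x :=
  have : IsContMDiffRiemannianBundle (𝓡 2) 1 Plane (fun x : M => TangentSpace (𝓡 2) x) :=
    IsContMDiffRiemannianBundle.of_le (n := ∞) ENat.LEInfty.out
  MDifferentiableAt.inner_bundle hV hW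

theorem SmoothFieldNear.inner (hV : SmoothFieldNear V x) (hW : SmoothFieldNear W x) :
    SmoothFunNear (fun y => inner ℝ (V y) (W y)) x := by
  filter_upwards [hV, hW] with y h1 h2 using ContMDiffAt.inner_bundle h1 h2

theorem mvfderiv_inner_smul_left (hf : DiffFunAt f x) (hV : DiffFieldAt V x)
    (hW : DiffFieldAt W x) (v : TangentSpace (𝓡 2) x) :
    mvfderiv (𝓡 2) (fun y => inner ℝ ((f • V) y) (W y)) x v =
      f x * mvfderiv (𝓡 2) (fun y => inner ℝ (V y) (W y)) x v
        + mvfderiv (𝓡 2) f x v * inner ℝ (V x) (W x) := by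
  have e : (fun y => inner ℝ ((f • V) y) (W y)) = fun y => f y * inner ℝ (V y) (W y) := by
    funext y; exact real_inner_smul_left _ _ _
  rw [e, mvfderiv_fun_mul hf (DiffFieldAt.inner hV hW)]
  simp [mul_comm]

theorem mvfderiv_inner_smul_right (hf : DiffFunAt f x) (hV : DiffFieldAt V x)
    (hW : DiffFieldAt W x) (v : TangentSpace (𝓡 2) x) :
    mvfderiv (𝓡 2) (fun y => inner ℝ (V y) ((f • W) y)) x v =
      f x * mvfderiv (𝓡 2) (fun y => inner ℝ (V y) (W y)) x v
        + mvfderiv (𝓡 2) f x v * inner ℝ (V x) (W x) := by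
  simp only [real_inner_comm _ (V _)]
  exact mvfderiv_inner_smul_left hf hW hV v

theorem mvfderiv_inner_add_left (hV : DiffFieldAt V x) (hX : DiffFieldAt X x)
    (hW : DiffFieldAt W x) (v : TangentSpace (𝓡 2) x) :
    mvfderiv (𝓡 2) (fun y => inner ℝ ((V + X) y) (W y)) x v =
      mvfderiv (𝓡 2) (fun y => inner ℝ (V y) (W y)) x v
        + mvfderiv (𝓡 2) (fun y => inner ℝ (X y) (W y)) x v := by
  have e : (fun y => inner ℝ ((V + X) y) (W y)) =
      fun y => inner ℝ (V y) (W y) + inner ℝ (X y) (W y) := by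
    funext y; exact inner_add_left _ _ _
  rw [e, mvfderiv_fun_add (DiffFieldAt.inner hV hW) (DiffFieldAt.inner hX hW)]
  simp

theorem mvfderiv_inner_add_right (hV : DiffFieldAt V x) (hX : DiffFieldAt X x)
    (hW : DiffFieldAt W x) (v : TangentSpace (𝓡 2) x) :
    mvfderiv (𝓡 2) (fun y => inner ℝ (W y) ((V + X) y)) x v =
      mvfderiv (𝓡 2) (fun y => inner ℝ (W y) (V y)) x v
        + mvfderiv (𝓡 2) (fun y => inner ℝ (W y) (X y)) x v := by
  simp only [real_inner_comm _ (W _)]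
  exact mvfderiv_inner_add_left hV hX hW v

/-- The derivatives of `f` produced by the metric terms cancel those produced by the brackets.
Tensoriality makes the value depend on the field only at `x`, so the extensions chosen in
`leviCivita` do not matter. -/
theorem tensorialAt_koszul_left (hY : DiffFieldAt Y x) (hZ : DiffFieldAt Z x) :
    TensorialAt (𝓡 2) Plane (fun X => koszul X Y Z x) x where
  smul {f X} hf hX := by
    simp only [koszul]
    rw [mvfderiv_inner_smul_left hf hX hZ, mvfderiv_inner_smul_left hf hX hY,
      VectorField.mlieBracket_smul_left hf hX, VectorField.mlieBracket_smul_left hf hX]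
    simp only [Pi.smul_apply', map_smul, inner_add_left, inner_neg_left, real_inner_smul_left,
      real_inner_smul_right, smul_eq_mul, neg_smul]
    ring
  add {X X'} hX hX' := by
    simp only [koszul]
    rw [mvfderiv_inner_add_left hX hX' hZ, mvfderiv_inner_add_left hX hX' hY,
      VectorField.mlieBracket_add_left hX hX', VectorField.mlieBracket_add_left hX hX']
    simp only [Pi.add_apply, map_add, inner_add_left, inner_add_right]
    ring

theorem tensorialAt_koszul_right (hX : DiffFieldAt X x) (hY : DiffFieldAt Y x) :
    TensorialAt (𝓡 2) Plane (fun Z => koszul X Y Z x) x where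
  smul {f Z} hf hZ := by
    simp only [koszul]
    rw [mvfderiv_inner_smul_right hf hY hZ, mvfderiv_inner_smul_right hf hX hZ,
      VectorField.mlieBracket_smul_right hf hZ, VectorField.mlieBracket_smul_right hf hZ]
    simp only [Pi.smul_apply', map_smul, inner_add_left, real_inner_smul_left,
      real_inner_smul_right, smul_eq_mul]
    rw [real_inner_comm (X x), real_inner_comm (Y x)]
    ring
  add {Z Z'} hZ hZ' := by
    simp only [koszul]
    rw [mvfderiv_inner_add_right hZ hZ' hY, mvfderiv_inner_add_right hZ hZ' hX,
      VectorField.mlieBracket_add_right hZ hZ', VectorField.mlieBracket_add_right hZ hZ']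
    simp only [Pi.add_apply, map_add, inner_add_left, inner_add_right]
    ring

/-- In this slot the two terms containing `df(X)` add instead of cancelling. Halved, they are the
inhomogeneous term of the Leibniz rule for `D`. -/
theorem koszul_smul_middle (hX : DiffFieldAt X x) (hY : DiffFieldAt Y x) (hZ : DiffFieldAt Z x)
    (hf : DiffFunAt f x) : koszul X (f • Y) Z x =
      f x * koszul X Y Z x + mvfderiv (𝓡 2) f x (X x) * inner ℝ (Y x) (Z x) := by
  simp only [koszul]
  rw [mvfderiv_inner_smul_left hf hY hZ, mvfderiv_inner_smul_right hf hX hY,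
    VectorField.mlieBracket_smul_right hf hY, VectorField.mlieBracket_smul_left hf hY]
  simp only [Pi.smul_apply', map_smul, inner_add_left, inner_neg_left, real_inner_smul_left,
    real_inner_smul_right, smul_eq_mul, neg_smul]
  rw [real_inner_comm (X x) (Y x)]
  ring

/-- The Koszul formula. -/
theorem inner_leviCivita_extField (hY : DiffFieldAt Y x) (hW : DiffFieldAt W x)
    (v : TangentSpace (𝓡 2) x) :
    inner ℝ (leviCivita Y x v) (W x) = koszul (extField v) Y W x := by
  have hT := tensorialAt_koszul_right (diffFieldAt_extField v) hY
  simp only [leviCivita, sum_inner, real_inner_smul_left]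
  let L : TangentSpace (𝓡 2) x →L[ℝ] ℝ := TensorialAt.mkHom _ x hT
  have h1 : L (W x) = koszul (extField v) Y W x := hT.mkHom_apply hW
  rw [← h1]
  conv_rhs => rw [← (onb x).sum_repr' (W x), map_sum]
  refine Finset.sum_congr rfl fun i _ => ?_
  rw [map_smul, smul_eq_mul, mul_comm]
  rfl

theorem inner_leviCivita (hX : DiffFieldAt X x) (hY : DiffFieldAt Y x) (hW : DiffFieldAt W x) :
    inner ℝ (leviCivita Y x (X x)) (W x) = koszul X Y W x := by
  rw [inner_leviCivita_extField hY hW]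
  exact (tensorialAt_koszul_left hY hW).pointwise (diffFieldAt_extField _) hX (by simp)

theorem ext_inner_field {v w : TangentSpace (𝓡 2) x}
    (h : ∀ Z : (x : M) → TangentSpace (𝓡 2) x, DiffFieldAt Z x →
      inner ℝ v (Z x) = inner ℝ w (Z x)) : v = w := by
  refine ext_inner_right ℝ fun z => ?_
  simpa using h (extField z) (diffFieldAt_extField z)

theorem leviCivita_add_vec (hY : DiffFieldAt Y x) (v w : TangentSpace (𝓡 2) x) :
    leviCivita Y x (v + w) = leviCivita Y x v + leviCivita Y x w := by
  refine ext_inner_field fun Z hZ => ?_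
  have hT := tensorialAt_koszul_left hY hZ
  simp only [inner_add_left, inner_leviCivita_extField hY hZ]
  exact (hT.mkHom _ _).map_add v w

theorem leviCivita_smul_vec (hY : DiffFieldAt Y x) (c : ℝ) (v : TangentSpace (𝓡 2) x) :
    leviCivita Y x (c • v) = c • leviCivita Y x v := by
  refine ext_inner_field fun Z hZ => ?_
  have hT := tensorialAt_koszul_left hY hZ
  simp only [real_inner_smul_left, inner_leviCivita_extField hY hZ]
  exact (hT.mkHom _ _).map_smul c v

/-- The Leibniz rule. -/
theorem leviCivita_smul (hf : DiffFunAt f x) (hY : DiffFieldAt Y x) (v : TangentSpace (𝓡 2) x) :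
    leviCivita (f • Y) x v = f x • leviCivita Y x v + mvfderiv (𝓡 2) f x v • Y x := by
  refine ext_inner_field fun Z hZ => ?_
  simp only [inner_add_left, real_inner_smul_left, inner_leviCivita_extField hY hZ,
    inner_leviCivita_extField (hf.smul_section hY) hZ]
  rw [koszul_smul_middle (diffFieldAt_extField v) hY hZ hf, extField_self]

/-- `D` is compatible with the metric. -/
theorem mvfderiv_inner (hY : DiffFieldAt Y x) (hZ : DiffFieldAt Z x) (v : TangentSpace (𝓡 2) x) :
    mvfderiv (𝓡 2) (fun y => inner ℝ (Y y) (Z y)) x v =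
      inner ℝ (leviCivita Y x v) (Z x) + inner ℝ (Y x) (leviCivita Z x v) := by
  rw [real_inner_comm _ (Y x), inner_leviCivita_extField hY hZ, inner_leviCivita_extField hZ hY]
  simp only [koszul, extField_self]
  rw [VectorField.mlieBracket_swap_apply (V := Z) (W := Y)]
  simp only [inner_neg_left, real_inner_comm (Z _) (Y _)]
  ring

/-- `D` is torsion-free. -/
theorem leviCivita_sub_leviCivita (hX : DiffFieldAt X x) (hY : DiffFieldAt Y x) :
    leviCivita Y x (X x) - leviCivita X x (Y x) = VectorField.mlieBracket (𝓡 2) X Y x := by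
  refine ext_inner_field fun Z hZ => ?_
  rw [inner_sub_left, inner_leviCivita hX hY hZ, inner_leviCivita hY hX hZ]
  simp only [koszul]
  rw [VectorField.mlieBracket_swap_apply (V := Y) (W := X)]
  simp only [inner_neg_left, real_inner_comm (X _) (Y _)]
  ring

theorem SmoothFieldNear.koszul (hX : SmoothFieldNear X x) (hY : SmoothFieldNear Y x)
    (hZ : SmoothFieldNear Z x) : SmoothFunNear (koszul X Y Z) x := by
  have h2 : SmoothFunNear (fun _ : M => (1 / 2 : ℝ)) x := .of_forall fun _ => contMDiffAt_const
  have := (((((((hY.inner hZ).deriv hX).add ((hX.inner hZ).deriv hY)).sub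
    ((hX.inner hY).deriv hZ)).add ((hX.bracket hY).inner hZ)).sub
    ((hX.bracket hZ).inner hY)).sub ((hY.bracket hZ).inner hX)).mul h2
  refine this.congr (.of_forall fun y => ?_)
  simp only [_root_.koszul]
  ring

end Connection

/-! ### Oriented Euclidean planes -/

section OrientedPlane

variable {E : Type*} [NormedAddCommGroup E] [InnerProductSpace ℝ E]
  [Fact (Module.finrank ℝ E = 2)] (o : Orientation ℝ E (Fin 2))

theorem Orientation.eq_inner_smul_add_inner_smul {e : E} (he : ‖e‖ = 1) (v : E) :
    v = inner ℝ v e • e + inner ℝ v (o.rightAngleRotation e) • o.rightAngleRotation e := by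
  refine ext_inner_right ℝ fun z => ?_
  have h := o.inner_mul_inner_add_areaForm_mul_areaForm e v z
  rw [he] at h
  rw [inner_add_left, real_inner_smul_left, real_inner_smul_left, real_inner_comm e v,
    real_inner_comm (o.rightAngleRotation e) v, o.inner_rightAngleRotation_left,
    o.inner_rightAngleRotation_left]
  linarith

/-- The area form is the determinant in a positively oriented orthonormal basis. Its sign is what
allows the orientation to be compared with continuous data. -/
theorem Orientation.areaForm_pos_of_basis (b : Module.Basis (Fin 2) ℝ E) (hb : b.orientation = o) :
    0 < o.areaForm (b 0) (b 1) := by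
  have h2 : Module.finrank ℝ E = 2 := Fact.out
  let c := o.finOrthonormalBasis two_pos h2
  have hc : c.toBasis.orientation = o := o.finOrthonormalBasis_orientation two_pos h2
  rw [o.areaForm_to_volumeForm, o.volumeForm_robust c hc]
  have := (c.toBasis.orientation_eq_iff_det_pos b).1 (hc.trans hb.symm)
  have e : ![b 0, b 1] = b := by
    funext i
    fin_cases i <;> rfl
  rwa [e]

/-- A skew-symmetric endomorphism of an oriented plane is a multiple of the rotation by a right
angle. -/
theorem Orientation.skew_eq_smul_rightAngleRotation {A : E → E}
    (hadd : ∀ v w, A (v + w) = A v + A w) (hsmul : ∀ (c : ℝ) v, A (c • v) = c • A v)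
    (hskew : ∀ v w, inner ℝ (A v) w + inner ℝ v (A w) = 0) {e : E} (he : ‖e‖ = 1) (v : E) :
    A v = inner ℝ (A e) (o.rightAngleRotation e) • o.rightAngleRotation v := by
  have hself : ∀ w, inner ℝ (A w) w = 0 := fun w => by
    have := hskew w w
    rw [real_inner_comm (A w) w] at this
    linarith
  have hJ : A (o.rightAngleRotation e) = -inner ℝ (A e) (o.rightAngleRotation e) • e := by
    rw [o.eq_inner_smul_add_inner_smul he (A (o.rightAngleRotation e)), hself,
      show inner ℝ (A (o.rightAngleRotation e)) e = -inner ℝ (A e) (o.rightAngleRotation e) by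
        have := hskew e (o.rightAngleRotation e)
        rw [real_inner_comm (A (o.rightAngleRotation e)) e] at this
        linarith]
    simp
  have hE : A e = inner ℝ (A e) (o.rightAngleRotation e) • o.rightAngleRotation e := by
    conv_lhs => rw [o.eq_inner_smul_add_inner_smul he (A e), hself]
    simp
  set c := inner ℝ (A e) (o.rightAngleRotation e)
  conv_lhs => rw [o.eq_inner_smul_add_inner_smul he v, hadd, hsmul, hsmul, hJ, hE]
  conv_rhs => rw [o.eq_inner_smul_add_inner_smul he v]
  simp only [map_add, map_smul, o.rightAngleRotation_rightAngleRotation]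
  module

end OrientedPlane

/-! ### Oriented orthonormal frames -/

section Frame

variable {M : Type*} [TopologicalSpace M] [ChartedSpace Plane M] [IsManifold (𝓡 2) ∞ M]
  [RiemannianBundle (fun x : M => TangentSpace (𝓡 2) x)]
  [IsContMDiffRiemannianBundle (𝓡 2) ∞ Plane (fun x : M => TangentSpace (𝓡 2) x)]
  {o : (x : M) → Orientation ℝ (TangentSpace (𝓡 2) x) (Fin 2)}
  {E₁ E₂ V W X Y Z : (x : M) → TangentSpace (𝓡 2) x} {f g : M → ℝ} {x : M}

theorem cplx_cplx (v : TangentSpace (𝓡 2) x) : cplx o x (cplx o x v) = -v :=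
  (o x).rightAngleRotation_rightAngleRotation v

theorem inner_cplx_self (v : TangentSpace (𝓡 2) x) : inner ℝ (cplx o x v) v = 0 :=
  (o x).inner_rightAngleRotation_self v

theorem inner_cplx_swap (v w : TangentSpace (𝓡 2) x) :
    inner ℝ (cplx o x v) w = -inner ℝ v (cplx o x w) :=
  (o x).inner_rightAngleRotation_swap' v w

theorem inner_cplx_cplx (v w : TangentSpace (𝓡 2) x) :
    inner ℝ (cplx o x v) (cplx o x w) = inner ℝ v w :=
  (o x).inner_comp_rightAngleRotation v w

theorem eq_of_unit {e : TangentSpace (𝓡 2) x} (he : ‖e‖ = 1) (v : TangentSpace (𝓡 2) x) :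
    v = inner ℝ v e • e + inner ℝ v (cplx o x e) • cplx o x e :=
  (o x).eq_inner_smul_add_inner_smul he v

variable (o) in
/-- `E₁, E₂` is a smooth oriented orthonormal frame near `x`. -/
structure IsOrientedFrameNear (E₁ E₂ : (x : M) → TangentSpace (𝓡 2) x) (x : M) : Prop where
  smooth₁ : SmoothFieldNear E₁ x
  smooth₂ : SmoothFieldNear E₂ x
  unit : ∀ᶠ y in 𝓝 x, ‖E₁ y‖ = 1
  rot : ∀ᶠ y in 𝓝 x, E₂ y = cplx o y (E₁ y)

theorem IsOrientedFrameNear.eventually (h : IsOrientedFrameNear o E₁ E₂ x) :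
    ∀ᶠ y in 𝓝 x, IsOrientedFrameNear o E₁ E₂ y := by
  filter_upwards [h.smooth₁.eventually, h.smooth₂.eventually, h.unit.eventually_nhds,
    h.rot.eventually_nhds] with y h1 h2 h3 h4 using ⟨h1, h2, h3, h4⟩

/-- Normalization of a nonvanishing smooth field. -/
theorem smoothFieldNear_normalize (hV : SmoothFieldNear V x) (h0 : V x ≠ 0) :
    SmoothFieldNear (fun y => (‖V y‖)⁻¹ • V y) x ∧ ∀ᶠ y in 𝓝 x, ‖(‖V y‖)⁻¹ • V y‖ = 1 := by
  have hc : ∀ᶠ y in 𝓝 x, inner ℝ (V y) (V y) ≠ 0 :=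
    (hV.inner hV).smooth.continuousAt.eventually_ne (inner_self_ne_zero.2 h0)
  constructor
  · refine SmoothFieldNear.smul (f := fun y => (‖V y‖)⁻¹) ?_ hV
    filter_upwards [hc, hV.inner hV] with y hy h1
    have e : (fun y => (‖V y‖)⁻¹) = fun y => (√(inner ℝ (V y) (V y)))⁻¹ := by
      funext z; rw [real_inner_self_eq_norm_sq, Real.sqrt_sq (norm_nonneg _)]
    rw [e]
    refine ContDiffAt.comp_contMDiffAt (g := fun t : ℝ => (√t)⁻¹) ?_ h1
    exact (Real.contDiffAt_sqrt hy).inv (by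
      rw [real_inner_self_eq_norm_sq] at hy ⊢
      rw [Real.sqrt_sq (norm_nonneg _)]
      exact fun h => hy (by rw [h]; simp))
  · filter_upwards [hc] with y hy
    have : ‖V y‖ ≠ 0 := fun h => hy (by rw [real_inner_self_eq_norm_sq, h]; simp)
    rw [norm_smul, norm_inv, norm_norm, inv_mul_cancel₀ this]

theorem exists_isOrientedFrameNear (ho : IsSurfaceOrientation o) (x : M) :
    ∃ E₁ E₂ : (x : M) → TangentSpace (𝓡 2) x, IsOrientedFrameNear o E₁ E₂ x := by
  set e := onb x 0
  have he : ‖e‖ = 1 := (onb x).orthonormal.1 0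
  have he0 : e ≠ 0 := fun h => by simp [h] at he
  have h1 := smoothFieldNear_normalize (smoothFieldNear_extField e) (by simpa using he0)
  set E₁ : (x : M) → TangentSpace (𝓡 2) x := fun y => (‖extField e y‖)⁻¹ • extField e y with hE₁
  have hE₁x : E₁ x = e := by
    simp only [hE₁]
    rw [extField_self, he, inv_one, one_smul]
  -- Gram–Schmidt is applied to extensions of `e` and `J e`, because smoothness of `J` is not yet
  -- available. The result satisfies `E₂ = ± J E₁`, and the remaining work is to exclude the minus
  -- sign near `x`.
  set B := extField (cplx o x e)
  have hB : SmoothFieldNear B x := smoothFieldNear_extField _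
  have hC : SmoothFieldNear (B + (fun y => (-inner ℝ (B y) (E₁ y) : ℝ)) • E₁) x :=
    hB.add (SmoothFieldNear.smul ((hB.inner h1.1).mono fun y hy => hy.neg) h1.1)
  set C := B + (fun y => (-inner ℝ (B y) (E₁ y) : ℝ)) • E₁ with hCd
  have hCx : C x = cplx o x e := by
    have : C x = B x + (-inner ℝ (B x) (E₁ x) : ℝ) • E₁ x := rfl
    rw [this, hE₁x, show B x = cplx o x e from extField_self _, inner_cplx_self]
    simp
  have hJe : ‖cplx o x e‖ = 1 := by
    rw [← he]; exact (o x).rightAngleRotation.norm_map e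
  have h2 := smoothFieldNear_normalize hC (by rw [hCx]; exact fun h => by simp [h] at hJe)
  set E₂ : (x : M) → TangentSpace (𝓡 2) x := fun y => (‖C y‖)⁻¹ • C y with hE₂
  have hE₂x : E₂ x = cplx o x e := by
    simp only [hE₂]
    rw [hCx, hJe, inv_one, one_smul]
  have horth : ∀ᶠ y in 𝓝 x, inner ℝ (E₂ y) (E₁ y) = 0 := by
    filter_upwards [h1.2] with y hy
    have e1 : E₂ y = (‖C y‖)⁻¹ • (B y + (-inner ℝ (B y) (E₁ y) : ℝ) • E₁ y) := rfl
    rw [e1, real_inner_smul_left, inner_add_left, real_inner_smul_left,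
      real_inner_self_eq_norm_sq (E₁ y), show ‖E₁ y‖ = 1 from hy]
    ring
  obtain ⟨T, hT, hTb⟩ := ho x
  have hcont : ∀ {U : (x : M) → TangentSpace (𝓡 2) x} (i : Fin 2), SmoothFieldNear U x →
      ContinuousAt (fun y => inner ℝ (T i y) (U y)) x := fun {U} i hU =>
    (DiffFieldAt.inner (hT i).diff hU.diff).continuousAt
  -- the determinant of the given frame in the orthonormal one
  set d : M → ℝ := fun y => inner ℝ (T 0 y) (E₁ y) * inner ℝ (T 1 y) (E₂ y) -
    inner ℝ (T 0 y) (E₂ y) * inner ℝ (T 1 y) (E₁ y) with hd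
  have hdc : ContinuousAt d x :=
    ((hcont 0 h1.1).mul (hcont 1 h2.1)).sub ((hcont 0 h2.1).mul (hcont 1 h1.1))
  -- the area form in terms of the determinant
  have harea : ∀ y, ‖E₁ y‖ = 1 → ‖E₂ y‖ = 1 → inner ℝ (E₂ y) (E₁ y) = 0 → ∃ s : ℝ,
      E₂ y = s • cplx o y (E₁ y) ∧ s * s = 1 ∧ (o y).areaForm (T 0 y) (T 1 y) = s * d y := by
    intro y hy1 hy2 hy3
    have hs := eq_of_unit (o := o) hy1 (E₂ y)
    rw [hy3, zero_smul, zero_add] at hs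
    have hcc : inner ℝ (cplx o y (E₁ y)) (cplx o y (E₁ y)) = 1 := by
      rw [inner_cplx_cplx, real_inner_self_eq_norm_sq, hy1, one_pow]
    have hss : inner ℝ (E₂ y) (cplx o y (E₁ y)) * inner ℝ (E₂ y) (cplx o y (E₁ y)) = 1 := by
      have h := real_inner_self_eq_norm_sq (E₂ y)
      rw [hy2, hs, real_inner_smul_left, real_inner_smul_right, hcc] at h
      rw [hs, real_inner_smul_left, hcc]
      linarith
    refine ⟨_, hs, hss, ?_⟩
    set s := inner ℝ (E₂ y) (cplx o y (E₁ y))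
    have h3 := (o y).inner_mul_areaForm_sub (E₁ y) (T 0 y) (T 1 y)
    rw [hy1, ← (o y).inner_rightAngleRotation_left (E₁ y),
      ← (o y).inner_rightAngleRotation_left (E₁ y)] at h3
    have h4 : ∀ v, inner ℝ ((o y).rightAngleRotation (E₁ y)) v = s * inner ℝ v (E₂ y) := by
      intro v
      rw [hs, real_inner_smul_right, ← mul_assoc, hss, one_mul]
      exact real_inner_comm _ _
    rw [h4, h4] at h3
    simp only [hd]
    rw [real_inner_comm (E₁ y) (T 0 y), real_inner_comm (E₁ y) (T 1 y)]
    linarith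
  -- At `x` the sign `s` is `1` by construction, so `d x` is positive. By continuity `d` stays
  -- positive nearby, and positivity of the area form on the given oriented frame then forces `s =
  -- 1` there too.
  have hdx : 0 < d x := by
    obtain ⟨b, hb, hbo⟩ := hTb.self_of_nhds
    have hp := (o x).areaForm_pos_of_basis b hbo
    obtain ⟨s, hs1, hs2, hs3⟩ := harea x h1.2.self_of_nhds h2.2.self_of_nhds horth.self_of_nhds
    rw [hb, hb, hs3] at hp
    have : s = 1 := by
      have h := congrArg (fun v => inner ℝ v (cplx o x e)) hs1
      simp only [hE₂x, hE₁x, real_inner_smul_left, real_inner_self_eq_norm_sq, hJe] at h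
      linarith
    rwa [this, one_mul] at hp
  refine ⟨E₁, E₂, h1.1, h2.1, h1.2, ?_⟩
  filter_upwards [h1.2, h2.2, horth, hTb, hdc.eventually_const_lt hdx] with y hy1 hy2 hy3 hyb hyd
  obtain ⟨b, hb, hbo⟩ := hyb
  have hp := (o y).areaForm_pos_of_basis b hbo
  obtain ⟨s, hs1, hs2, hs3⟩ := harea y hy1 hy2 hy3
  rw [hb, hb, hs3] at hp
  have hs0 : 0 < s := by
    by_contra! h
    nlinarith
  have : s = 1 := by nlinarith
  rw [hs1, this, one_smul]

end Frame

/-! ### Curvature in an orthonormal frame -/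

section Curvature

variable {M : Type*} [TopologicalSpace M] [ChartedSpace Plane M] [IsManifold (𝓡 2) ∞ M]
  [RiemannianBundle (fun x : M => TangentSpace (𝓡 2) x)]
  [IsContMDiffRiemannianBundle (𝓡 2) ∞ Plane (fun x : M => TangentSpace (𝓡 2) x)]
  {o : (x : M) → Orientation ℝ (TangentSpace (𝓡 2) x) (Fin 2)}
  {E₁ E₂ V W X Y Z : (x : M) → TangentSpace (𝓡 2) x} {f g : M → ℝ} {x : M}

namespace IsOrientedFrameNear

variable (h : IsOrientedFrameNear o E₁ E₂ x)
include h

theorem inner₁₁ : ∀ᶠ y in 𝓝 x, inner ℝ (E₁ y) (E₁ y) = 1 := by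
  filter_upwards [h.unit] with y hy
  rw [real_inner_self_eq_norm_sq, hy, one_pow]

theorem inner₂₂ : ∀ᶠ y in 𝓝 x, inner ℝ (E₂ y) (E₂ y) = 1 := by
  filter_upwards [h.inner₁₁, h.rot] with y hy hr
  rw [hr, inner_cplx_cplx, hy]

theorem inner₁₂ : ∀ᶠ y in 𝓝 x, inner ℝ (E₁ y) (E₂ y) = 0 := by
  filter_upwards [h.rot] with y hr
  rw [hr, real_inner_comm, inner_cplx_self]

theorem eq_sum (v : TangentSpace (𝓡 2) x) :
    v = inner ℝ v (E₁ x) • E₁ x + inner ℝ v (E₂ x) • E₂ x := by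
  rw [h.rot.self_of_nhds]
  exact eq_of_unit h.unit.self_of_nhds v

theorem ext {v w : TangentSpace (𝓡 2) x} (h1 : inner ℝ v (E₁ x) = inner ℝ w (E₁ x))
    (h2 : inner ℝ v (E₂ x) = inner ℝ w (E₂ x)) : v = w := by
  rw [h.eq_sum v, h.eq_sum w, h1, h2]

theorem inner_cplx₁ (v : TangentSpace (𝓡 2) x) :
    inner ℝ (cplx o x v) (E₁ x) = -inner ℝ v (E₂ x) := by
  rw [inner_cplx_swap, ← h.rot.self_of_nhds]

theorem inner_cplx₂ (v : TangentSpace (𝓡 2) x) :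
    inner ℝ (cplx o x v) (E₂ x) = inner ℝ v (E₁ x) := by
  rw [h.rot.self_of_nhds, inner_cplx_cplx]

/-- A field is smooth if its components are. -/
theorem smoothField (h1 : SmoothFunNear (fun y => inner ℝ (W y) (E₁ y)) x)
    (h2 : SmoothFunNear (fun y => inner ℝ (W y) (E₂ y)) x) : SmoothFieldNear W x := by
  refine (SmoothFieldNear.add (SmoothFieldNear.smul h1 h.smooth₁)
    (SmoothFieldNear.smul h2 h.smooth₂)).congr ?_
  filter_upwards [h.eventually] with y hy using hy.eq_sum (W y)

theorem smooth_cplx (hW : SmoothFieldNear W x) : SmoothFieldNear (fun y => cplx o y (W y)) x := by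
  refine h.smoothField ?_ ?_
  · have h2 : SmoothFunNear (fun y => -inner ℝ (W y) (E₂ y)) x :=
      (hW.inner h.smooth₂).mono fun y hy => hy.neg
    refine h2.congr ?_
    filter_upwards [h.eventually] with y hy using hy.inner_cplx₁ (W y)
  · refine (hW.inner h.smooth₁).congr ?_
    filter_upwards [h.eventually] with y hy using hy.inner_cplx₂ (W y)

theorem smooth_leviCivita (hW : SmoothFieldNear W x) (hX : SmoothFieldNear X x) :
    SmoothFieldNear (fun y => leviCivita W y (X y)) x := by
  refine h.smoothField ?_ ?_
  · refine (hX.koszul hW h.smooth₁).congr ?_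
    filter_upwards [hX.eventually, hW.eventually, h.eventually] with y h1 h2 h3
    exact inner_leviCivita h1.diff h2.diff h3.smooth₁.diff
  · refine (hX.koszul hW h.smooth₂).congr ?_
    filter_upwards [hX.eventually, hW.eventually, h.eventually] with y h1 h2 h3
    exact inner_leviCivita h1.diff h2.diff h3.smooth₂.diff

/-- Differentiating `|E₁|² = 1` kills the `E₁` component. The remaining coefficient `θ(v) = h(D_v
E₁, E₂)` is the connection form, and it determines `D` completely. -/
theorem leviCivita₁ (v : TangentSpace (𝓡 2) x) :
    leviCivita E₁ x v = inner ℝ (leviCivita E₁ x v) (E₂ x) • E₂ x := by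
  have h1 := mvfderiv_inner h.smooth₁.diff h.smooth₁.diff v
  rw [mvfderiv_congr (g := fun _ => (1 : ℝ)) h.inner₁₁, mvfderiv_const,
    real_inner_comm (leviCivita E₁ x v) (E₁ x)] at h1
  refine h.ext ?_ ?_
  · rw [real_inner_smul_left, real_inner_comm (E₁ x) (E₂ x), h.inner₁₂.self_of_nhds]
    simp only [_root_.zero_apply] at h1
    linarith
  · rw [real_inner_smul_left, h.inner₂₂.self_of_nhds, mul_one]

theorem leviCivita₂ (v : TangentSpace (𝓡 2) x) :
    leviCivita E₂ x v = -inner ℝ (leviCivita E₁ x v) (E₂ x) • E₁ x := by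
  have h1 := mvfderiv_inner h.smooth₂.diff h.smooth₂.diff v
  have h2 := mvfderiv_inner h.smooth₁.diff h.smooth₂.diff v
  rw [mvfderiv_congr (g := fun _ => (1 : ℝ)) h.inner₂₂, mvfderiv_const,
    real_inner_comm (leviCivita E₂ x v) (E₂ x)] at h1
  rw [mvfderiv_congr (g := fun _ => (0 : ℝ)) h.inner₁₂, mvfderiv_const,
    real_inner_comm (leviCivita E₂ x v) (E₁ x)] at h2
  simp only [_root_.zero_apply] at h1 h2
  refine h.ext ?_ ?_
  · rw [real_inner_smul_left, h.inner₁₁.self_of_nhds]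
    linarith
  · rw [real_inner_smul_left, h.inner₁₂.self_of_nhds]
    linarith

/-- With `θ` the connection form and `w₁`, `w₂` the components of `W`, covariant differentiation
reads `(dw₁ - θ w₂, dw₂ + θ w₁)`. -/
theorem inner_leviCivita₁ (hW : DiffFieldAt W x) (v : TangentSpace (𝓡 2) x) :
    inner ℝ (leviCivita W x v) (E₁ x) =
      mvfderiv (𝓡 2) (fun y => inner ℝ (W y) (E₁ y)) x v -
        inner ℝ (leviCivita E₁ x v) (E₂ x) * inner ℝ (W x) (E₂ x) := by
  rw [mvfderiv_inner hW h.smooth₁.diff, ← real_inner_smul_right, ← h.leviCivita₁]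
  ring

theorem inner_leviCivita₂ (hW : DiffFieldAt W x) (v : TangentSpace (𝓡 2) x) :
    inner ℝ (leviCivita W x v) (E₂ x) =
      mvfderiv (𝓡 2) (fun y => inner ℝ (W y) (E₂ y)) x v +
        inner ℝ (leviCivita E₁ x v) (E₂ x) * inner ℝ (W x) (E₁ x) := by
  rw [mvfderiv_inner hW h.smooth₂.diff, h.leviCivita₂ v, real_inner_smul_right]
  ring

/-- The complex structure is parallel. -/
theorem leviCivita_cplx (hW : SmoothFieldNear W x) (v : TangentSpace (𝓡 2) x) :
    leviCivita (fun y => cplx o y (W y)) x v = cplx o x (leviCivita W x v) := by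
  have hJ := (h.smooth_cplx hW).diff
  have e1 : (fun y => inner ℝ (cplx o y (W y)) (E₁ y)) =ᶠ[𝓝 x]
      -(fun y => inner ℝ (W y) (E₂ y)) := by
    filter_upwards [h.eventually] with y hy using hy.inner_cplx₁ (W y)
  have e2 : (fun y => inner ℝ (cplx o y (W y)) (E₂ y)) =ᶠ[𝓝 x] fun y => inner ℝ (W y) (E₁ y) := by
    filter_upwards [h.eventually] with y hy using hy.inner_cplx₂ (W y)
  refine h.ext ?_ ?_
  · rw [h.inner_leviCivita₁ hJ, h.inner_cplx₂, h.inner_cplx₁, h.inner_leviCivita₂ hW.diff,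
      mvfderiv_congr e1, mvfderiv_neg]
    simp only [_root_.neg_apply]
    ring
  · rw [h.inner_leviCivita₂ hJ, h.inner_cplx₂, h.inner_cplx₁, h.inner_leviCivita₁ hW.diff,
      mvfderiv_congr e2]
    ring

omit h in
/-- The curvature form of a frame: the exterior derivative of the connection form, evaluated on two
fields. -/
noncomputable def curvForm (E₁ E₂ X Z : (x : M) → TangentSpace (𝓡 2) x) (x : M) : ℝ :=
  mvfderiv (𝓡 2) (fun y => inner ℝ (leviCivita E₁ y (Z y)) (E₂ y)) x (X x)
    - mvfderiv (𝓡 2) (fun y => inner ℝ (leviCivita E₁ y (X y)) (E₂ y)) x (Z x)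
    - inner ℝ (leviCivita E₁ x (VectorField.mlieBracket (𝓡 2) X Z x)) (E₂ x)

/-- Cartan's second structure equation. -/
theorem curvature_eq_smul_cplx (hX : SmoothFieldNear X x) (hZ : SmoothFieldNear Z x)
    (hW : SmoothFieldNear W x) :
    leviCivita (fun y => leviCivita W y (Z y)) x (X x)
      - leviCivita (fun y => leviCivita W y (X y)) x (Z x)
      - leviCivita W x (VectorField.mlieBracket (𝓡 2) X Z x) =
    curvForm E₁ E₂ X Z x • cplx o x (W x) := by
  have hw₁ := hW.inner h.smooth₁
  have hw₂ := hW.inner h.smooth₂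
  have hθ : ∀ {T : (x : M) → TangentSpace (𝓡 2) x}, SmoothFieldNear T x →
      SmoothFunNear (fun y => inner ℝ (leviCivita E₁ y (T y)) (E₂ y)) x := fun hT =>
    (h.smooth_leviCivita h.smooth₁ hT).inner h.smooth₂
  -- The component formula is iterated. On antisymmetrizing in `S` and `T`, the terms quadratic in
  -- `θ` and the mixed first-order terms drop out by symmetry, and the second derivatives of the
  -- components form a bracket term. Only `dθ` remains.
  have key₁ : ∀ {S T : (x : M) → TangentSpace (𝓡 2) x}, SmoothFieldNear S x →
      SmoothFieldNear T x →
      inner ℝ (leviCivita (fun y => leviCivita W y (T y)) x (S x)) (E₁ x) =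
        mvfderiv (𝓡 2) (fun y => mvfderiv (𝓡 2) (fun z => inner ℝ (W z) (E₁ z)) y (T y)) x (S x)
        - inner ℝ (leviCivita E₁ x (T x)) (E₂ x) *
            mvfderiv (𝓡 2) (fun y => inner ℝ (W y) (E₂ y)) x (S x)
        - inner ℝ (W x) (E₂ x) *
            mvfderiv (𝓡 2) (fun y => inner ℝ (leviCivita E₁ y (T y)) (E₂ y)) x (S x)
        - inner ℝ (leviCivita E₁ x (S x)) (E₂ x) *
            (mvfderiv (𝓡 2) (fun y => inner ℝ (W y) (E₂ y)) x (T x) +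
              inner ℝ (leviCivita E₁ x (T x)) (E₂ x) * inner ℝ (W x) (E₁ x)) := by
    intro S T hS hT
    have e : (fun y => inner ℝ (leviCivita W y (T y)) (E₁ y)) =ᶠ[𝓝 x] fun y =>
        mvfderiv (𝓡 2) (fun z => inner ℝ (W z) (E₁ z)) y (T y) -
          inner ℝ (leviCivita E₁ y (T y)) (E₂ y) * inner ℝ (W y) (E₂ y) := by
      filter_upwards [h.eventually, hW.eventually] with y h1 h2
      exact h1.inner_leviCivita₁ h2.diff (T y)
    rw [h.inner_leviCivita₁ (h.smooth_leviCivita hW hT).diff, h.inner_leviCivita₂ hW.diff,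
      mvfderiv_congr e, mvfderiv_fun_sub (hw₁.deriv hT).diff ((hθ hT).mul hw₂).diff,
      mvfderiv_fun_mul (hθ hT).diff hw₂.diff]
    simp only [_root_.sub_apply, _root_.add_apply,
      _root_.smul_apply, smul_eq_mul]
    ring
  have key₂ : ∀ {S T : (x : M) → TangentSpace (𝓡 2) x}, SmoothFieldNear S x →
      SmoothFieldNear T x →
      inner ℝ (leviCivita (fun y => leviCivita W y (T y)) x (S x)) (E₂ x) =
        mvfderiv (𝓡 2) (fun y => mvfderiv (𝓡 2) (fun z => inner ℝ (W z) (E₂ z)) y (T y)) x (S x)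
        + inner ℝ (leviCivita E₁ x (T x)) (E₂ x) *
            mvfderiv (𝓡 2) (fun y => inner ℝ (W y) (E₁ y)) x (S x)
        + inner ℝ (W x) (E₁ x) *
            mvfderiv (𝓡 2) (fun y => inner ℝ (leviCivita E₁ y (T y)) (E₂ y)) x (S x)
        + inner ℝ (leviCivita E₁ x (S x)) (E₂ x) *
            (mvfderiv (𝓡 2) (fun y => inner ℝ (W y) (E₁ y)) x (T x) -
              inner ℝ (leviCivita E₁ x (T x)) (E₂ x) * inner ℝ (W x) (E₂ x)) := by
    intro S T hS hT
    have e : (fun y => inner ℝ (leviCivita W y (T y)) (E₂ y)) =ᶠ[𝓝 x] fun y =>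
        mvfderiv (𝓡 2) (fun z => inner ℝ (W z) (E₂ z)) y (T y) +
          inner ℝ (leviCivita E₁ y (T y)) (E₂ y) * inner ℝ (W y) (E₁ y) := by
      filter_upwards [h.eventually, hW.eventually] with y h1 h2
      exact h1.inner_leviCivita₂ h2.diff (T y)
    rw [h.inner_leviCivita₂ (h.smooth_leviCivita hW hT).diff, h.inner_leviCivita₁ hW.diff,
      mvfderiv_congr e, mvfderiv_fun_add (hw₂.deriv hT).diff ((hθ hT).mul hw₁).diff,
      mvfderiv_fun_mul (hθ hT).diff hw₁.diff]
    simp only [_root_.add_apply, _root_.smul_apply, smul_eq_mul]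
    ring
  refine h.ext ?_ ?_
  · rw [inner_sub_left, inner_sub_left, key₁ hX hZ, key₁ hZ hX, h.inner_leviCivita₁ hW.diff,
      mvfderiv_mlieBracket hw₁ hX hZ, real_inner_smul_left, h.inner_cplx₁, curvForm]
    ring
  · rw [inner_sub_left, inner_sub_left, key₂ hX hZ, key₂ hZ hX, h.inner_leviCivita₂ hW.diff,
      mvfderiv_mlieBracket hw₂ hX hZ, real_inner_smul_left, h.inner_cplx₂, curvForm]
    ring

omit h in
theorem curvForm_swap (h : IsOrientedFrameNear o E₁ E₂ x) :
    curvForm E₁ E₂ X Z x = -curvForm E₁ E₂ Z X x := by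
  have : leviCivita E₁ x (-VectorField.mlieBracket (𝓡 2) Z X x) =
      -leviCivita E₁ x (VectorField.mlieBracket (𝓡 2) Z X x) := by
    rw [← neg_one_smul ℝ, leviCivita_smul_vec h.smooth₁.diff, neg_one_smul]
  rw [curvForm, curvForm, VectorField.mlieBracket_swap_apply, this, inner_neg_left]
  ring

theorem curvature_eq (u v w : TangentSpace (𝓡 2) x) :
    curvature x u v w = curvForm E₁ E₂ (extField u) (extField v) x • cplx o x w := by
  have := h.curvature_eq_smul_cplx (smoothFieldNear_extField u) (smoothFieldNear_extField v)
    (smoothFieldNear_extField w)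
  simp only [extField_self] at this
  exact this

/-- The basis `onb x` need not be positively oriented. The last factor is `±1` and compensates for
its orientation. -/
theorem scalarCurvature_eq : scalarCurvature x =
    2 * (curvForm E₁ E₂ (extField (onb x 0)) (extField (onb x 1)) x *
      inner ℝ (cplx o x (onb x 1)) (onb x 0)) := by
  simp only [scalarCurvature, Fin.sum_univ_two, h.curvature_eq, real_inner_smul_left,
    inner_cplx_self]
  rw [h.curvForm_swap (X := extField (onb x 1)), inner_cplx_swap (onb x 0),
    real_inner_comm (cplx o x (onb x 1))]
  ring

end IsOrientedFrameNear

end Curvature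

/-! ### Killing fields on a surface -/

section Killing

variable {M : Type*} [TopologicalSpace M] [ChartedSpace Plane M] [IsManifold (𝓡 2) ∞ M]
  [RiemannianBundle (fun x : M => TangentSpace (𝓡 2) x)]
  [IsContMDiffRiemannianBundle (𝓡 2) ∞ Plane (fun x : M => TangentSpace (𝓡 2) x)]
  {o : (x : M) → Orientation ℝ (TangentSpace (𝓡 2) x) (Fin 2)}
  {V W X Y Z : (x : M) → TangentSpace (𝓡 2) x} {f g : M → ℝ} {x : M}

theorem IsSmoothField.near (hY : IsSmoothField Y) (x : M) : SmoothFieldNear Y x :=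
  .of_forall fun y => hY y

theorem sum_mvfderiv_mul_inner (f : M → ℝ) (v : TangentSpace (𝓡 2) x) :
    ∑ i, mvfderiv (𝓡 2) f x (onb x i) * inner ℝ v (onb x i) = mvfderiv (𝓡 2) f x v := by
  conv_rhs => rw [← (onb x).sum_repr' v, map_sum]
  refine Finset.sum_congr rfl fun i _ => ?_
  rw [map_smul, smul_eq_mul, mul_comm, real_inner_comm]

theorem extDerivForm_dualForm (hY : DiffFieldAt Y x) (v w : TangentSpace (𝓡 2) x) :
    extDerivForm (dualForm Y) x v w =
      inner ℝ (leviCivita Y x v) w - inner ℝ (leviCivita Y x w) v := by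
  have hv := diffFieldAt_extField v
  have hw := diffFieldAt_extField w
  have h := leviCivita_sub_leviCivita hv hw
  simp only [extField_self] at h
  have h1 := mvfderiv_inner hY hw v
  have h2 := mvfderiv_inner hY hv w
  simp only [extField_self] at h1 h2
  simp only [extDerivForm, dualForm, innerSL_apply_apply]
  rw [h1, h2, ← h, inner_sub_right]
  ring

/-- The covariant derivative of a Killing field is skew-symmetric. -/
theorem inner_leviCivita_add_of_killing (hY : DiffFieldAt Y x) (v w : TangentSpace (𝓡 2) x)
    (hk : lieDerivMetric Y x v w = 0) :
    inner ℝ (leviCivita Y x v) w + inner ℝ v (leviCivita Y x w) = 0 := by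
  have hv := diffFieldAt_extField v
  have hw := diffFieldAt_extField w
  rw [lieDerivMetric, mvfderiv_inner hv hw, ← leviCivita_sub_leviCivita hY hv,
    ← leviCivita_sub_leviCivita hY hw] at hk
  simp only [extField_self, inner_sub_left, inner_sub_right] at hk
  linarith

/-- A skew endomorphism of the plane is a multiple `a J`. Each of the two terms defining the Faraday
function equals `-2 a`, whence the factor `-1/4`. -/
theorem leviCivita_eq_of_killing (hY : DiffFieldAt Y x)
    (hk : ∀ v w, lieDerivMetric Y x v w = 0) (v : TangentSpace (𝓡 2) x) :
    leviCivita Y x v = (-faraday o Y x / 4) • cplx o x v := by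
  have hskew := fun v w => inner_leviCivita_add_of_killing hY v w (hk v w)
  have he : ∀ i, ‖onb x i‖ = 1 := (onb x).orthonormal.1
  have key : ∀ v, leviCivita Y x v =
      inner ℝ (leviCivita Y x (onb x 0)) (cplx o x (onb x 0)) • cplx o x v := fun v =>
    (o x).skew_eq_smul_rightAngleRotation (leviCivita_add_vec hY) (leviCivita_smul_vec hY) hskew
      (he 0) v
  set a := inner ℝ (leviCivita Y x (onb x 0)) (cplx o x (onb x 0))
  have hF : faraday o Y x = -4 * a := by
    have h1 : ∀ i, extDerivForm (dualForm Y) x (onb x i) (cplx o x (onb x i)) = 2 * a := by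
      intro i
      rw [extDerivForm_dualForm hY, key, key (cplx o x (onb x i)), cplx_cplx,
        real_inner_smul_left, real_inner_smul_left, inner_cplx_cplx, inner_neg_left,
        real_inner_self_eq_norm_sq, he]
      ring
    simp only [faraday, h1, Fin.sum_univ_two]
    ring
  rw [key v, hF]
  congr 1
  ring

/-- The bases `onb` vary with the point without any continuity. Rewriting the Faraday function in a
smooth frame is what makes its smoothness visible. -/
theorem IsOrientedFrameNear.faraday_eventuallyEq {E₁ E₂ : (x : M) → TangentSpace (𝓡 2) x}
    (h : IsOrientedFrameNear o E₁ E₂ x) (hY : IsSmoothField Y)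
    (hk : ∀ x v w, lieDerivMetric Y x v w = 0) :
    faraday o Y =ᶠ[𝓝 x] fun y => -4 * inner ℝ (leviCivita Y y (E₁ y)) (E₂ y) := by
  filter_upwards [h.eventually] with y hy
  rw [leviCivita_eq_of_killing (o := o) (hY.near y).diff (hk y), real_inner_smul_left, hy.inner_cplx₂,
    hy.inner₁₁.self_of_nhds]
  ring

theorem smoothFunNear_faraday (ho : IsSurfaceOrientation o) (hY : IsSmoothField Y)
    (hk : ∀ x v w, lieDerivMetric Y x v w = 0) (x : M) : SmoothFunNear (faraday o Y) x := by
  obtain ⟨E₁, E₂, h⟩ := exists_isOrientedFrameNear ho x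
  have h4 : SmoothFunNear (fun _ : M => (-4 : ℝ)) x := .of_forall fun _ => contMDiffAt_const
  exact (h4.mul ((h.smooth_leviCivita (hY.near x) h.smooth₁).inner h.smooth₂)).congr
    (h.faraday_eventuallyEq hY hk)

/-- The derivative of the Faraday function of a Killing field. -/
theorem mvfderiv_faraday (ho : IsSurfaceOrientation o) (hY : IsSmoothField Y)
    (hk : ∀ x v w, lieDerivMetric Y x v w = 0) (v : TangentSpace (𝓡 2) x) :
    mvfderiv (𝓡 2) (faraday o Y) x v = 2 * scalarCurvature x * inner ℝ (Y x) (cplx o x v) := by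
  obtain ⟨E₁, E₂, h⟩ := exists_isOrientedFrameNear ho x
  set F := faraday o Y with hFd
  have hF : SmoothFunNear F x := smoothFunNear_faraday ho hY hk x
  set a : M → ℝ := fun y => -1 / 4 * F y with had
  have h4 : SmoothFunNear (fun _ : M => (-1 / 4 : ℝ)) x := .of_forall fun _ => contMDiffAt_const
  have ha : SmoothFunNear a x := h4.mul hF
  have hda : ∀ w, mvfderiv (𝓡 2) a x w = -1 / 4 * mvfderiv (𝓡 2) F x w := by
    intro w
    rw [had, mvfderiv_fun_mul h4.diff hF.diff, mvfderiv_const]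
    simp
  have hD : ∀ y w, leviCivita Y y w = a y • cplx o y w := by
    intro y w
    rw [leviCivita_eq_of_killing (o := o) (hY.near y).diff (hk y)]
    congr 1
    simp only [had, hFd]
    ring
  -- the derivative of `D_Z Y = a J Z`
  have hDD : ∀ {S T : (x : M) → TangentSpace (𝓡 2) x}, SmoothFieldNear S x → SmoothFieldNear T x →
      leviCivita (fun y => leviCivita Y y (T y)) x (S x) =
        a x • cplx o x (leviCivita T x (S x)) + mvfderiv (𝓡 2) a x (S x) • cplx o x (T x) := by
    intro S T hS hT
    have e : (fun y => leviCivita Y y (T y)) = a • fun y => cplx o y (T y) :=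
      funext fun y => hD y (T y)
    rw [e, leviCivita_smul ha.diff (h.smooth_cplx hT).diff, h.leviCivita_cplx hT]
  set e₀ := onb x 0
  set e₁ := onb x 1
  have s₀ := smoothFieldNear_extField e₀
  have s₁ := smoothFieldNear_extField e₁
  -- The curvature applied to `Y` is computed twice. The structure equation gives `k J Y`.
  -- Differentiating `D_Z Y = a J Z`, with `J` parallel and `D` torsion-free, gives `da(e₀) J e₁ -
  -- da(e₁) J e₀`.
  have hK := h.curvature_eq_smul_cplx s₀ s₁ (hY.near x)
  have hR := h.scalarCurvature_eq
  set k := IsOrientedFrameNear.curvForm E₁ E₂ (extField e₀) (extField e₁) x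
  rw [hDD s₀ s₁, hDD s₁ s₀, hD, ← leviCivita_sub_leviCivita s₀.diff s₁.diff] at hK
  simp only [extField_self, map_sub] at hK
  have hK' : mvfderiv (𝓡 2) a x e₀ • e₁ - mvfderiv (𝓡 2) a x e₁ • e₀ = k • Y x := by
    have h2 : mvfderiv (𝓡 2) a x e₀ • cplx o x e₁ - mvfderiv (𝓡 2) a x e₁ • cplx o x e₀ =
        k • cplx o x (Y x) := by
      rw [← hK]
      module
    have h3 := congrArg (cplx o x) h2
    simp only [map_sub, map_smul, cplx_cplx] at h3
    linear_combination (norm := module) -h3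
  have n₀ : inner ℝ e₀ e₀ = 1 := by
    rw [real_inner_self_eq_norm_sq, (onb x).orthonormal.1 0, one_pow]
  have n₁ : inner ℝ e₁ e₁ = 1 := by
    rw [real_inner_self_eq_norm_sq, (onb x).orthonormal.1 1, one_pow]
  have n₀₁ : inner ℝ e₀ e₁ = 0 := (onb x).orthonormal.2 (by decide)
  have n₁₀ : inner ℝ e₁ e₀ = 0 := (onb x).orthonormal.2 (by decide)
  have q₀ := congrArg (fun z => inner ℝ z e₁) hK'
  have q₁ := congrArg (fun z => inner ℝ z e₀) hK'
  simp only [inner_sub_left, real_inner_smul_left, n₀, n₁, n₀₁, n₁₀] at q₀ q₁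
  -- the rotation in the orthonormal basis
  set s := inner ℝ (cplx o x e₁) e₀
  have hbasis : ∀ z : TangentSpace (𝓡 2) x, z = inner ℝ e₀ z • e₀ + inner ℝ e₁ z • e₁ := by
    intro z
    have := (onb x).sum_repr' z
    rw [Fin.sum_univ_two] at this
    exact this.symm
  have hJ₁ : cplx o x e₁ = s • e₀ := by
    conv_lhs => rw [hbasis (cplx o x e₁), real_inner_comm (cplx o x e₁) e₁, inner_cplx_self,
      real_inner_comm (cplx o x e₁) e₀]
    simp [s]
  have hJ₀ : cplx o x e₀ = -s • e₁ := by
    have h1 : inner ℝ e₁ (cplx o x e₀) = -s := by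
      have := inner_cplx_swap (o := o) e₁ e₀
      linarith
    conv_lhs => rw [hbasis (cplx o x e₀), real_inner_comm (cplx o x e₀) e₀, inner_cplx_self, h1]
    simp
  have hs : s * s = 1 := by
    have := inner_cplx_cplx (o := o) e₁ e₁
    rw [hJ₁, real_inner_smul_left, real_inner_smul_right, n₀, n₁] at this
    linarith
  have hv : mvfderiv (𝓡 2) a x v = -(1 / 2) * scalarCurvature x * inner ℝ (Y x) (cplx o x v) := by
    conv_lhs => rw [hbasis v, map_add, map_smul, map_smul]
    conv_rhs => rw [hbasis v]
    rw [map_add, map_smul, map_smul, hJ₀, hJ₁, hR]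
    simp only [inner_add_right, real_inner_smul_right, smul_eq_mul]
    have q₀' : mvfderiv (𝓡 2) a x e₀ = k * inner ℝ (Y x) e₁ := by linarith
    have q₁' : mvfderiv (𝓡 2) a x e₁ = -(k * inner ℝ (Y x) e₀) := by linarith
    rw [q₀', q₁']
    linear_combination (-(inner ℝ e₀ v * k * inner ℝ (Y x) e₁) +
      inner ℝ e₁ v * k * inner ℝ (Y x) e₀) * hs
  rw [hda] at hv
  linarith

theorem mvfderiv_norm_sq_of_killing (hY : IsSmoothField Y)
    (hk : ∀ x v w, lieDerivMetric Y x v w = 0) (v : TangentSpace (𝓡 2) x) :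
    mvfderiv (𝓡 2) (fun y => ‖Y y‖ ^ 2) x v =
      -(1 / 2) * faraday o Y x * inner ℝ (Y x) (cplx o x v) := by
  have e : (fun y => ‖Y y‖ ^ 2) = fun y => inner ℝ (Y y) (Y y) :=
    funext fun y => (real_inner_self_eq_norm_sq (Y y)).symm
  rw [e, mvfderiv_inner (hY.near x).diff (hY.near x).diff,
    leviCivita_eq_of_killing (o := o) (hY.near x).diff (hk x), real_inner_smul_left,
    real_inner_smul_right, real_inner_comm (cplx o x v) (Y x)]
  ring

/-- The Laplacian of a function whose derivative is a multiple of `⋆γ` for a Killing field. -/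
theorem laplacian_eq_of_killing (ho : IsSurfaceOrientation o) (hY : IsSmoothField Y)
    (hk : ∀ x v w, lieDerivMetric Y x v w = 0) {c : M → ℝ} (hc : SmoothFunNear c x)
    (hf : ∀ y v, mvfderiv (𝓡 2) f y v = c y * inner ℝ (Y y) (cplx o y v)) :
    laplacian f x = -(c x * faraday o Y x / 2 + mvfderiv (𝓡 2) c x (cplx o x (Y x))) := by
  obtain ⟨E₁, E₂, h⟩ := exists_isOrientedFrameNear ho x
  -- Skewness of `J` turns `c h(Y, J ·)` into the dual of `-c J Y`. Since `DY` is a multiple of `J`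
  -- and `J² = -1`, the covariant derivative of `J Y` is a multiple of the identity, whose trace is
  -- immediate.
  have hg : grad f = (fun y => -c y) • fun y => cplx o y (Y y) := by
    funext y
    refine ext_inner_right ℝ fun z => ?_
    have h1 := sum_mvfderiv_mul_inner f z
    simp only [grad, sum_inner, real_inner_smul_left, real_inner_comm z (onb y _)]
    rw [h1, hf]
    change _ = inner ℝ (-c y • cplx o y (Y y)) z
    rw [real_inner_smul_left, inner_cplx_swap]
    ring
  have hn : ∀ v, mvfderiv (𝓡 2) (fun y => -c y) x v = -mvfderiv (𝓡 2) c x v := by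
    intro v
    rw [mvfderiv_fun_neg]
    rfl
  have hcn : DiffFunAt (fun y => -c y) x := hc.diff.neg
  have hD : ∀ v, leviCivita (grad f) x v =
      (-c x * faraday o Y x / 4) • v - mvfderiv (𝓡 2) c x v • cplx o x (Y x) := by
    intro v
    rw [hg, leviCivita_smul hcn (h.smooth_cplx (hY.near x)).diff, h.leviCivita_cplx (hY.near x),
      leviCivita_eq_of_killing (o := o) (hY.near x).diff (hk x), hn, map_smul, cplx_cplx]
    module
  have h1 := sum_mvfderiv_mul_inner c (cplx o x (Y x))
  simp only [laplacian, hD, inner_sub_left, real_inner_smul_left, Finset.sum_sub_distrib]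
  rw [h1, ← Finset.mul_sum]
  have h2 : ∑ i, inner ℝ (onb x i) (onb x i) = (2 : ℝ) := by
    simp [(onb x).orthonormal.1]
  rw [h2]
  ring

end Killing

/-! ### Functions on connected surfaces controlled by their derivative -/

section Connected

variable {M : Type*} [TopologicalSpace M] [ChartedSpace Plane M] [IsManifold (𝓡 2) ∞ M]

/-- The derivative of a function read in a chart. -/
theorem hasFDerivAt_comp_extChartAt_symm {E : Type*} [NormedAddCommGroup E] [NormedSpace ℝ E]
    {f : M → E} {x : M} {u : Plane} (hu : u ∈ (extChartAt (𝓡 2) x).target)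
    (hf : MDifferentiableAt (𝓡 2) 𝓘(ℝ, E) f ((extChartAt (𝓡 2) x).symm u)) :
    HasFDerivAt (f ∘ (extChartAt (𝓡 2) x).symm)
      ((mvfderiv (𝓡 2) f ((extChartAt (𝓡 2) x).symm u)).comp
        (mfderivWithin 𝓘(ℝ, Plane) (𝓡 2) (extChartAt (𝓡 2) x).symm (Set.range (𝓡 2)) u) :
        Plane →L[ℝ] E) u := by
  have hr : Set.range (𝓡 2) = Set.univ := ModelWithCorners.range_eq_univ _
  have h1 := mdifferentiableWithinAt_extChartAt_symm (I := 𝓡 2) hu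
  have h2 := h1.hasMFDerivWithinAt
  rw [hr] at h2 ⊢
  have h3 := HasMFDerivAt.comp u hf.hasMFDerivAt (hasMFDerivWithinAt_univ.1 h2)
  exact hasMFDerivAt_iff_hasFDerivAt.1 h3

theorem exists_ball_subset_extChartAt_target (x : M) {p : Plane → Prop}
    (hp : ∀ᶠ u in 𝓝 (extChartAt (𝓡 2) x x), p u) :
    ∃ r > 0, ∀ u ∈ Metric.ball (extChartAt (𝓡 2) x x) r, u ∈ (extChartAt (𝓡 2) x).target ∧ p u :=
  Metric.eventually_nhds_iff_ball.1
    (Filter.Eventually.and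
      (extChartAt_target_mem_nhds (I := 𝓡 2) x : ∀ᶠ u in 𝓝 _, u ∈ (extChartAt (𝓡 2) x).target) hp)

theorem eventually_of_ball {x : M} {p : M → Prop} {r : ℝ} (hr : 0 < r)
    (h : ∀ u ∈ Metric.ball (extChartAt (𝓡 2) x x) r, p ((extChartAt (𝓡 2) x).symm u)) :
    ∀ᶠ y in 𝓝 x, p y := by
  filter_upwards [(continuousAt_extChartAt (I := 𝓡 2) x).preimage_mem_nhds
    (Metric.ball_mem_nhds _ hr), extChartAt_source_mem_nhds (I := 𝓡 2) x] with y hy hs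
  have := h _ hy
  rwa [(extChartAt (𝓡 2) x).left_inv hs] at this

/-- A function with vanishing derivative on a connected manifold is constant. -/
theorem exists_eq_const_of_mvfderiv_eq_zero [PreconnectedSpace M] [Nonempty M] {E : Type*}
    [NormedAddCommGroup E] [NormedSpace ℝ E] {f : M → E} (hf : MDifferentiable (𝓡 2) 𝓘(ℝ, E) f)
    (h0 : ∀ x, mvfderiv (𝓡 2) f x = 0) : ∃ c : E, ∀ x, f x = c := by
  have hloc : IsLocallyConstant f := by
    rw [IsLocallyConstant.iff_eventually_eq]
    intro x
    obtain ⟨r, hr, hball⟩ := exists_ball_subset_extChartAt_target x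
      (p := fun _ => True) (.of_forall fun _ => trivial)
    refine eventually_of_ball hr fun u hu => ?_
    have hd : ∀ w ∈ Metric.ball (extChartAt (𝓡 2) x x) r, HasFDerivWithinAt
        (f ∘ (extChartAt (𝓡 2) x).symm) (0 : Plane →L[ℝ] E)
        (Metric.ball (extChartAt (𝓡 2) x x) r) w := by
      intro w hw
      have := hasFDerivAt_comp_extChartAt_symm (hball w hw).1 (hf _)
      refine (this.congr_fderiv ?_).hasFDerivWithinAt
      rw [h0]
      rfl
    have h1 := (convex_ball _ _).norm_image_sub_le_of_norm_hasFDerivWithin_le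
      (C := 0) hd (fun w _ => by simp) (Metric.mem_ball_self hr) hu
    simp only [Function.comp_apply, zero_mul, norm_le_zero_iff, sub_eq_zero] at h1
    rw [h1, extChartAt_to_inv]
  exact ⟨f (Classical.arbitrary M), fun x => hloc.apply_eq_of_preconnectedSpace x _⟩

/-- A continuous function without zeros on a connected space has a definite sign. -/
theorem hasDefiniteSign_of_ne_zero {N : Type*} [TopologicalSpace N] [PreconnectedSpace N]
    {f : N → ℝ} (hf : Continuous f) (h0 : ∀ x, f x ≠ 0) : HasDefiniteSign f := by
  by_contra! h
  simp only [HasDefiniteSign, not_or, not_forall, not_lt] at h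
  obtain ⟨⟨a, ha⟩, ⟨b, hb⟩⟩ := h
  obtain ⟨c, -, hc⟩ := isPreconnected_univ.intermediate_value (Set.mem_univ a) (Set.mem_univ b)
    hf.continuousOn ⟨ha, hb⟩
  exact h0 c hc

variable [RiemannianBundle (fun x : M => TangentSpace (𝓡 2) x)]
  [IsContMDiffRiemannianBundle (𝓡 2) ∞ Plane (fun x : M => TangentSpace (𝓡 2) x)]

theorem le_of_opNorm_lt {E E' : Type*} {_ : NormedAddCommGroup E} {_ : NormedSpace ℝ E}
    {_ : NormedAddCommGroup E'} {_ : NormedSpace ℝ E'} {D : E →L[ℝ] E'} {C : ℝ} (h : ‖D‖ < C)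
    (v : E) : ‖D v‖ ≤ C * ‖v‖ :=
  D.le_of_opNorm_le h.le v

/-- A solution of a homogeneous linear first-order equation on a connected manifold that vanishes
somewhere vanishes identically. -/
theorem eq_zero_of_abs_mvfderiv_le [PreconnectedSpace M] {f b : M → ℝ}
    (hf : MDifferentiable (𝓡 2) 𝓘(ℝ, ℝ) f) (hb : Continuous b)
    (h : ∀ x (v : TangentSpace (𝓡 2) x), |mvfderiv (𝓡 2) f x v| ≤ |f x| * (b x * ‖v‖))
    {x₀ : M} (h0 : f x₀ = 0) (x : M) : f x = 0 := by
  have hcl : IsClosed {y | f y = 0} := isClosed_eq hf.continuous continuous_const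
  have hop : IsOpen {y | f y = 0} := by
    rw [isOpen_iff_mem_nhds]
    intro z hz
    have : IsContinuousRiemannianBundle Plane (fun x : M => TangentSpace (𝓡 2) x) := by
      obtain ⟨G, hG, hG'⟩ := IsContMDiffRiemannianBundle.exists_contMDiff (IB := 𝓡 2) (n := ∞)
        (F := Plane) (E := fun x : M => TangentSpace (𝓡 2) x)
      exact ⟨G, hG.continuous, hG'⟩
    -- `C` bounds the `h`-length of the image of a Euclidean vector under the inverse chart.
    -- Combined with a local bound on `b`, it yields along each chart segment an inequality `|g'| ≤
    -- K |g|` with `K` constant, and Grönwall's inequality propagates the zero.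
    obtain ⟨C, hC, hCe⟩ := eventually_norm_mfderivWithin_symm_extChartAt_lt (𝓡 2) z
    rw [ModelWithCorners.range_eq_univ, nhdsWithin_univ] at hCe
    have hbe : ∀ᶠ u in 𝓝 (extChartAt (𝓡 2) z z), b ((extChartAt (𝓡 2) z).symm u) < |b z| + 1 := by
      have hc : ContinuousAt (b ∘ (extChartAt (𝓡 2) z).symm) (extChartAt (𝓡 2) z z) :=
        hb.continuousAt.comp (continuousAt_extChartAt_symm (I := 𝓡 2) z)
      refine hc.eventually_lt continuousAt_const ?_
      simp only [Function.comp_apply, extChartAt_to_inv]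
      linarith [le_abs_self (b z)]
    obtain ⟨r, hr, hball⟩ := exists_ball_subset_extChartAt_target z (hCe.and hbe)
    refine eventually_of_ball hr fun u hu => ?_
    set u₀ := extChartAt (𝓡 2) z z
    set g := f ∘ (extChartAt (𝓡 2) z).symm with hg
    set K := (|b z| + 1) * (C * ‖u - u₀‖) with hK
    have hmem : ∀ t ∈ Set.Icc (0 : ℝ) 1, u₀ + t • (u - u₀) ∈ Metric.ball u₀ r := fun t ht =>
      (convex_ball u₀ r).add_smul_sub_mem (Metric.mem_ball_self hr) hu ht
    have hder : ∀ t ∈ Set.Icc (0 : ℝ) 1, ∃ d : ℝ,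
        HasDerivAt (fun t : ℝ => g (u₀ + t • (u - u₀))) d t ∧
          |d| ≤ K * |g (u₀ + t • (u - u₀))| := by
      intro t ht
      obtain ⟨ht1, ht2, ht3⟩ := hball _ (hmem t ht)
      have h1 := hasFDerivAt_comp_extChartAt_symm ht1 (hf _)
      have h2 : HasDerivAt (fun t : ℝ => u₀ + t • (u - u₀)) (u - u₀) t := by
        simpa using ((hasDerivAt_id t).smul_const (u - u₀)).const_add u₀
      refine ⟨_, HasFDerivAt.comp_hasDerivAt (l := g) t h1 h2, ?_⟩
      set w := u₀ + t • (u - u₀)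
      set D := mfderivWithin 𝓘(ℝ, Plane) (𝓡 2) (extChartAt (𝓡 2) z).symm (Set.range (𝓡 2)) w
        with hD
      have h3 := h ((extChartAt (𝓡 2) z).symm w) (D (u - u₀))
      rw [ModelWithCorners.range_eq_univ] at hD
      have h4 : ‖D (u - u₀)‖ ≤ C * ‖u - u₀‖ := by
        rw [hD]
        exact le_of_opNorm_lt ht2 (u - u₀)
      refine h3.trans ?_
      rw [mul_comm K]
      refine mul_le_mul_of_nonneg_left ?_ (abs_nonneg _)
      exact mul_le_mul ht3.le h4 (norm_nonneg _) (by positivity)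
    choose! d hd hdK using hder
    have hz' := eq_zero_of_abs_deriv_le_mul_abs_self_of_eq_zero_right
      (f := fun t : ℝ => g (u₀ + t • (u - u₀))) (f' := d) (K := K) (a := 0) (b := 1)
      (fun t ht => (hd t ht).continuousAt.continuousWithinAt)
      (fun t ht => (hd t ⟨ht.1, ht.2.le⟩).hasDerivWithinAt)
      (by simpa [hg, u₀] using hz)
      (fun t ht => hdK t ⟨ht.1, ht.2.le⟩) 1 ⟨zero_le_one, le_rfl⟩
    simpa [hg] using hz'
  have := (show IsClopen {y | f y = 0} from ⟨hcl, hop⟩).eq_univ ⟨x₀, h0⟩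
  have hx : x ∈ {y | f y = 0} := this ▸ Set.mem_univ x
  exact hx

end Connected

/-! ### Chain rules for functions into normed spaces -/

section ChainRule

variable {M : Type*} [TopologicalSpace M] [ChartedSpace Plane M] {x : M}
  {E₁ E₂ E₃ : Type*} [NormedAddCommGroup E₁] [NormedSpace ℝ E₁] [NormedAddCommGroup E₂]
  [NormedSpace ℝ E₂] [NormedAddCommGroup E₃] [NormedSpace ℝ E₃]

theorem mvfderiv_comp_of_hasFDerivAt {f : M → E₁} {φ : E₁ → E₂} {φ' : E₁ →L[ℝ] E₂}
    (hf : MDifferentiableAt (𝓡 2) 𝓘(ℝ, E₁) f x) (hφ : HasFDerivAt φ φ' (f x))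
    (v : TangentSpace (𝓡 2) x) :
    mvfderiv (𝓡 2) (fun y => φ (f y)) x v = φ' (mvfderiv (𝓡 2) f x v) := by
  have h := HasMFDerivAt.comp x hφ.hasMFDerivAt hf.hasMFDerivAt
  have h' := h.mfderiv
  simp only [mvfderiv]
  change (mfderiv (𝓡 2) 𝓘(ℝ, E₂) (φ ∘ f) x) v = _
  rw [h']
  rfl

theorem mvfderiv_prodMk {f₁ : M → E₁} {f₂ : M → E₂}
    (h₁ : MDifferentiableAt (𝓡 2) 𝓘(ℝ, E₁) f₁ x) (h₂ : MDifferentiableAt (𝓡 2) 𝓘(ℝ, E₂) f₂ x)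
    (v : TangentSpace (𝓡 2) x) :
    mvfderiv (𝓡 2) (fun y => (f₁ y, f₂ y)) x v =
      (mvfderiv (𝓡 2) f₁ x v, mvfderiv (𝓡 2) f₂ x v) := by
  have h' : HasMFDerivAt (𝓡 2) 𝓘(ℝ, E₁ × E₂) (fun y => (f₁ y, f₂ y)) x
      (ContinuousLinearMap.prod (mfderiv (𝓡 2) 𝓘(ℝ, E₁) f₁ x) (mfderiv (𝓡 2) 𝓘(ℝ, E₂) f₂ x)) :=
    ⟨h₁.continuousAt.prodMk h₂.continuousAt, h₁.hasMFDerivAt.2.prodMk h₂.hasMFDerivAt.2⟩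
  have h := h'.mfderiv
  simp only [mvfderiv]
  rw [h]
  rfl

/-- The derivative of a function of two functions, computed along a line. -/
theorem mvfderiv_comp₂ {f₁ : M → E₁} {f₂ : M → E₂} {φ : E₁ × E₂ → E₃}
    (h₁ : MDifferentiableAt (𝓡 2) 𝓘(ℝ, E₁) f₁ x) (h₂ : MDifferentiableAt (𝓡 2) 𝓘(ℝ, E₂) f₂ x)
    (hφ : DifferentiableAt ℝ φ (f₁ x, f₂ x)) {v : TangentSpace (𝓡 2) x} {c : E₃}
    (hc : HasDerivAt (fun t : ℝ => φ (f₁ x + t • mvfderiv (𝓡 2) f₁ x v,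
      f₂ x + t • mvfderiv (𝓡 2) f₂ x v)) c 0) :
    mvfderiv (𝓡 2) (fun y => φ (f₁ y, f₂ y)) x v = c := by
  rw [mvfderiv_comp_of_hasFDerivAt (f := fun y => (f₁ y, f₂ y)) (h₁.prodMk_space h₂)
    hφ.hasFDerivAt, mvfderiv_prodMk h₁ h₂]
  set p : E₁ × E₂ := (f₁ x, f₂ x) with hp
  set w : E₁ × E₂ := (mvfderiv (𝓡 2) f₁ x v, mvfderiv (𝓡 2) f₂ x v)
  have hl : HasDerivAt (fun t : ℝ => p + t • w) w 0 := by
    simpa using ((hasDerivAt_id (0 : ℝ)).smul_const w).const_add p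
  have h0 : p + (0 : ℝ) • w = p := by simp
  have h3 := HasFDerivAt.comp_hasDerivAt (l := φ) (0 : ℝ) (h0.symm ▸ hφ.hasFDerivAt) hl
  rw [h0] at h3
  exact h3.unique hc

end ChainRule

/-! ### Solutions of the real vortex equations -/

section Vortex

variable {M : Type*} [TopologicalSpace M] [ChartedSpace Plane M] [IsManifold (𝓡 2) ∞ M]
  [RiemannianBundle (fun x : M => TangentSpace (𝓡 2) x)]
  [IsContMDiffRiemannianBundle (𝓡 2) ∞ Plane (fun x : M => TangentSpace (𝓡 2) x)]
  {o : (x : M) → Orientation ℝ (TangentSpace (𝓡 2) x) (Fin 2)}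
  {Y : (x : M) → TangentSpace (𝓡 2) x} {ε τ : ℝ} {x : M}

theorem smoothFunNear_norm_sq (hY : IsSmoothField Y) (x : M) :
    SmoothFunNear (fun y => ‖Y y‖ ^ 2) x := by
  simp_rw [← real_inner_self_eq_norm_sq]
  exact SmoothFieldNear.inner (hY.near x) (hY.near x)

theorem SmoothFunNear.const (c : ℝ) (x : M) : SmoothFunNear (fun _ : M => c) x :=
  .of_forall fun _ => contMDiffAt_const

theorem contMDiff_of_smoothFunNear {f : M → ℝ} (h : ∀ x, SmoothFunNear f x) :
    ContMDiff (𝓡 2) 𝓘(ℝ, ℝ) ∞ f := fun x => (h x).smooth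

variable (hτ : ∀ x : M, τ = scalarCurvature x + 4 * ε * ‖Y x‖ ^ 2)
include hτ

theorem scalarCurvature_eq_sub :
    (scalarCurvature : M → ℝ) = fun x => τ - 4 * ε * ‖Y x‖ ^ 2 :=
  funext fun x => by linarith [hτ x]

/-- Smoothness comes from the vortex equation, which expresses `R` through `|Y|²`. The pointwise
bases in the definition of the scalar curvature need not be touched. -/
theorem smoothFunNear_scalarCurvature (hY : IsSmoothField Y) (x : M) :
    SmoothFunNear (scalarCurvature : M → ℝ) x := by
  rw [scalarCurvature_eq_sub hτ]
  exact (SmoothFunNear.const τ x).sub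
    ((SmoothFunNear.const (4 * ε) x).mul (smoothFunNear_norm_sq hY x))

theorem mvfderiv_scalarCurvature (hY : IsSmoothField Y)
    (hk : ∀ x v w, lieDerivMetric Y x v w = 0) (v : TangentSpace (𝓡 2) x) :
    mvfderiv (𝓡 2) scalarCurvature x v =
      2 * ε * faraday o Y x * inner ℝ (Y x) (cplx o x v) := by
  rw [scalarCurvature_eq_sub hτ,
    mvfderiv_comp_of_hasFDerivAt (f := fun y => ‖Y y‖ ^ 2) (φ := fun t => τ - 4 * ε * t)
      (smoothFunNear_norm_sq hY x).diff
      (((hasDerivAt_id _).const_mul (4 * ε)).const_sub τ).hasFDerivAt,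
    mvfderiv_norm_sq_of_killing (o := o) hY hk]
  simp
  ring

end Vortex

/-! ### First integrals of the linear system for `R` and `F`, and descent of the moment map -/

section Constancy

variable {M : Type*} [TopologicalSpace M] [ChartedSpace Plane M] [IsManifold (𝓡 2) ∞ M]
  [RiemannianBundle (fun x : M => TangentSpace (𝓡 2) x)]
  [IsContMDiffRiemannianBundle (𝓡 2) ∞ Plane (fun x : M => TangentSpace (𝓡 2) x)]
  {o : (x : M) → Orientation ℝ (TangentSpace (𝓡 2) x) (Fin 2)}
  {Y : (x : M) → TangentSpace (𝓡 2) x} {ε : ℝ} {R F : M → ℝ}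

/-- Both differentials are multiples of `h(Y, J ·)`, with coefficients for which `2 R dR` and `2 ε F
dF` coincide. -/
theorem exists_sq_sub_sq_eq_const [ConnectedSpace M] (hR : MDifferentiable (𝓡 2) 𝓘(ℝ, ℝ) R)
    (hF : MDifferentiable (𝓡 2) 𝓘(ℝ, ℝ) F)
    (dR : ∀ x v, mvfderiv (𝓡 2) R x v = 2 * ε * F x * inner ℝ (Y x) (cplx o x v))
    (dF : ∀ x v, mvfderiv (𝓡 2) F x v = 2 * R x * inner ℝ (Y x) (cplx o x v)) :
    ∃ σ, ∀ x, R x ^ 2 - ε * F x ^ 2 = σ := by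
  have hφ : Differentiable ℝ (fun p : ℝ × ℝ => p.1 ^ 2 - ε * p.2 ^ 2) := by fun_prop
  refine exists_eq_const_of_mvfderiv_eq_zero (f := fun x => R x ^ 2 - ε * F x ^ 2)
    (fun x => ?_) fun x => ?_
  · exact (hφ.differentiableAt.mdifferentiableAt (x := (R x, F x))).comp x
      ((hR x).prodMk_space (hF x))
  · ext v
    refine mvfderiv_comp₂ (φ := fun p : ℝ × ℝ => p.1 ^ 2 - ε * p.2 ^ 2) (hR x) (hF x)
      hφ.differentiableAt ?_
    have hl : ∀ a b : ℝ, HasDerivAt (fun t : ℝ => a + t • b) b 0 := fun a b => by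
      simpa using ((hasDerivAt_id (0 : ℝ)).smul_const b).const_add a
    convert! (((hl (R x) (mvfderiv (𝓡 2) R x v)).pow 2).sub
      (((hl (F x) (mvfderiv (𝓡 2) F x v)).pow 2).const_mul ε)) using 1
    rw [dR, dF]
    simp
    ring

/-- A complex solution `G` of `dG = -s G ⋆γ` is a multiple of the exponential of a moment map on
the universal cover. -/
theorem exists_exp_mul_eq_const {N : Type*} [TopologicalSpace N] [ChartedSpace Plane N]
    {pr : N → M} {μ : N → ℝ} (hpr : IsUniversalCover pr) (hμ : IsMomentMapAlong o pr Y μ)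
    {G : M → ℂ} {s : ℂ} (hG : MDifferentiable (𝓡 2) 𝓘(ℝ, ℂ) G)
    (dG : ∀ x v, mvfderiv (𝓡 2) G x v = s * G x * (inner ℝ (Y x) (cplx o x v) : ℝ)) :
    ∃ c : ℂ, ∀ x, Complex.exp (-s * μ x) * G (pr x) = c := by
  have := hpr.isManifold
  have := hpr.simplyConnected
  have hprd : MDifferentiable (𝓡 2) (𝓡 2) pr := hpr.localDiffeo.mdifferentiable (by simp)
  have hμd : MDifferentiable (𝓡 2) 𝓘(ℝ, ℝ) μ := hμ.1.mdifferentiable (by simp)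
  have hGd : MDifferentiable (𝓡 2) 𝓘(ℝ, ℂ) (fun y => G (pr y)) := hG.comp hprd
  have hφ : Differentiable ℝ (fun p : ℝ × ℂ => Complex.exp (-s * p.1) * p.2) := by
    have : Differentiable ℝ (fun t : ℝ => (t : ℂ)) := Complex.ofRealCLM.differentiable
    fun_prop
  refine exists_eq_const_of_mvfderiv_eq_zero
    (f := fun x => Complex.exp (-s * μ x) * G (pr x)) (fun x => ?_) fun x => ?_
  · exact (hφ.differentiableAt.mdifferentiableAt (x := (μ x, G (pr x)))).comp x
      ((hμd x).prodMk_space (hGd x))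
  · ext v
    refine mvfderiv_comp₂ (φ := fun p : ℝ × ℂ => Complex.exp (-s * p.1) * p.2) (hμd x) (hGd x)
      hφ.differentiableAt ?_
    have e1 : mvfderiv (𝓡 2) μ x v =
        inner ℝ (Y (pr x)) (cplx o (pr x) (mfderiv (𝓡 2) (𝓡 2) pr x v)) := by
      rw [hμ.2 x]
      simp [hodge, dualForm]
    have e2 : mvfderiv (𝓡 2) (fun y => G (pr y)) x v =
        mvfderiv (𝓡 2) G (pr x) (mfderiv (𝓡 2) (𝓡 2) pr x v) :=
      mfderiv_comp_apply x (hG (pr x)) (hprd x) v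
    rw [dG, ← e1] at e2
    rw [e2]
    set m := mvfderiv (𝓡 2) μ x v
    have h1 : HasDerivAt (fun t : ℝ => ((μ x + t • m : ℝ) : ℂ)) (m : ℂ) 0 := by
      have : HasDerivAt (fun t : ℝ => μ x + t • m) m 0 := by
        simpa using ((hasDerivAt_id (0 : ℝ)).smul_const m).const_add (μ x)
      exact this.ofReal_comp
    have h2 : HasDerivAt (fun t : ℝ => G (pr x) + t • (s * G (pr x) * (m : ℂ)))
        (s * G (pr x) * (m : ℂ)) 0 := by
      simpa using ((hasDerivAt_id (0 : ℝ)).smul_const (s * G (pr x) * (m : ℂ))).const_add (G (pr x))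
    convert! ((h1.const_mul (-s)).cexp.mul h2) using 1
    simp
    ring

/-- Solving `G ∘ pr = c exp(s μ)` for `μ` gives `log (G / c) / s`, which depends only on the point
of `M`. A point of `N` shows that `c` has the sign of `G`, so the logarithm has a positive argument
on all of `M`. -/
theorem exists_isMomentMap_of_hasDefiniteSign {N : Type*} [Nonempty N] {pr : N → M} {μ : N → ℝ}
    {G : M → ℝ} {s c : ℝ} (hs : s ≠ 0) (hG : ContMDiff (𝓡 2) 𝓘(ℝ, ℝ) ∞ G)
    (dG : ∀ x v, mvfderiv (𝓡 2) G x v = s * G x * inner ℝ (Y x) (cplx o x v))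
    (hsign : HasDefiniteSign G) (hc : ∀ x, Real.exp (-s * μ x) * G (pr x) = c) :
    ∃ m : M → ℝ, IsMomentMap o Y m ∧ ∀ x, μ x = m (pr x) := by
  have hpos : ∀ x, 0 < G x / c := by
    intro x
    have n₀ : N := Classical.arbitrary N
    rw [← hc n₀]
    rcases hsign with h | h
    · exact div_pos (h x) (mul_pos (Real.exp_pos _) (h _))
    · exact div_pos_of_neg_of_neg (h x) (mul_neg_of_pos_of_neg (Real.exp_pos _) (h _))
  have hc0 : ∀ _ : M, c ≠ 0 := fun x h => by simpa [h] using hpos x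
  refine ⟨fun x => Real.log (G x / c) / s, ⟨fun x => ?_, fun x => ?_⟩, fun x => ?_⟩
  · have h1 : ContDiffAt ℝ ∞ (fun t : ℝ => Real.log (t / c) / s) (G x) :=
      ((contDiffAt_id.div_const c).log (hpos x).ne').div_const s
    exact h1.contMDiffAt.comp x (hG x)
  · ext v
    have h1 : HasDerivAt (fun t : ℝ => Real.log (t / c) / s) (1 / c / (G x / c) / s) (G x) :=
      (((hasDerivAt_id (G x)).div_const c).log (hpos x).ne').div_const s
    rw [mvfderiv_comp_of_hasFDerivAt (f := G) (φ := fun t => Real.log (t / c) / s)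
      ((hG x).mdifferentiableAt (by simp)) h1.hasFDerivAt, dG]
    have hG0 : G x ≠ 0 := fun h => by simpa [h] using hpos x
    have := hc0 x
    simp [hodge, dualForm]
    field_simp
  · have h1 := hc x
    have hc0' := hc0 (pr x)
    have h2 : G (pr x) / c = Real.exp (s * μ x) := by
      rw [div_eq_iff hc0', ← h1, ← mul_assoc, ← Real.exp_add]
      simp
    simp only [h2, Real.log_exp]
    field_simp

/-- A solution of `dG = -s G ⋆γ` that is not identically zero has a definite sign. -/
theorem hasDefiniteSign_of_mvfderiv_eq [PreconnectedSpace M] {G : M → ℝ} {s : ℝ}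
    (hY : IsSmoothField Y) (hG : MDifferentiable (𝓡 2) 𝓘(ℝ, ℝ) G)
    (dG : ∀ x v, mvfderiv (𝓡 2) G x v = s * G x * inner ℝ (Y x) (cplx o x v))
    (h0 : ∃ x, G x ≠ 0) : HasDefiniteSign G := by
  refine hasDefiniteSign_of_ne_zero hG.continuous fun y hy => ?_
  obtain ⟨x, hx⟩ := h0
  have hcont : Continuous fun x => ‖Y x‖ := by
    have h := (contMDiff_of_smoothFunNear (smoothFunNear_norm_sq hY)).continuous.sqrt
    simpa [Real.sqrt_sq (norm_nonneg _)] using h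
  refine hx (eq_zero_of_abs_mvfderiv_le hG (b := fun x => |s| * ‖Y x‖) (by fun_prop)
    (fun x v => ?_) hy x)
  have h1 := abs_real_inner_le_norm (Y x) (cplx o x v)
  have h2 : ‖cplx o x v‖ = ‖v‖ := (o x).rightAngleRotation.norm_map v
  rw [h2] at h1
  rw [dG, abs_mul, abs_mul]
  calc |s| * |G x| * |inner ℝ (Y x) (cplx o x v)| ≤ |s| * |G x| * (‖Y x‖ * ‖v‖) := by gcongr
    _ = _ := by ring

end Constancy

/-! ### Maximal integral curves -/

section IntegralCurves

variable {M : Type*} [TopologicalSpace M] [ChartedSpace Plane M] [IsManifold (𝓡 2) ∞ M]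
  {Y : (x : M) → TangentSpace (𝓡 2) x} {ν ν' : ℝ → M} {s s' : Set ℝ}

theorem IsIntegralCurveOnInterval.at (h : IsIntegralCurveOnInterval ν Y s) {t : ℝ} (ht : t ∈ s) :
    IsMIntegralCurveAt ν Y t := h.2.2.2.isMIntegralCurveAt (h.1.mem_nhds ht)

theorem isIntegralCurveOnInterval_of_at (h₁ : IsOpen s) (h₂ : s.OrdConnected) (h₃ : s.Nonempty)
    (h : ∀ t ∈ s, IsMIntegralCurveAt ν Y t) : IsIntegralCurveOnInterval ν Y s :=
  ⟨h₁, h₂, h₃, IsMIntegralCurveAt.isMIntegralCurveOn h⟩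

theorem IsMIntegralCurveAt.congr_of_eventuallyEq {t : ℝ} (h : IsMIntegralCurveAt ν Y t)
    (h' : ν' =ᶠ[𝓝 t] ν) : IsMIntegralCurveAt ν' Y t := by
  filter_upwards [h, h'.eventuallyEq_nhds] with u hu hu'
  have := hu.congr_of_eventuallyEq hu'
  rw [hu'.self_of_nhds]
  exact this

theorem exists_Ioo_subset_of_ordConnected {U : Set ℝ} (hU : IsOpen U) (hU' : U.OrdConnected)
    {t₀ t : ℝ} (h₀ : t₀ ∈ U) (h : t ∈ U) :
    ∃ a b, t₀ ∈ Set.Ioo a b ∧ t ∈ Set.Ioo a b ∧ Set.Ioo a b ⊆ U := by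
  have key : ∀ u ∈ U, ∃ r > 0, u - r ∈ U ∧ u + r ∈ U := by
    intro u hu
    obtain ⟨r, hr, hr'⟩ := Metric.isOpen_iff.1 hU u hu
    refine ⟨r / 2, half_pos hr, hr' ?_, hr' ?_⟩ <;>
      simp [abs_of_pos hr, hr]
  obtain ⟨r₀, hr₀, h1, h2⟩ := key t₀ h₀
  obtain ⟨r, hr, h3, h4⟩ := key t h
  rcases le_total t₀ t with hle | hle
  · exact ⟨t₀ - r₀, t + r, ⟨by linarith, by linarith⟩, ⟨by linarith, by linarith⟩,
      Set.Ioo_subset_Icc_self.trans (hU'.out h1 h4)⟩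
  · exact ⟨t - r, t₀ + r₀, ⟨by linarith, by linarith⟩, ⟨by linarith, by linarith⟩,
      Set.Ioo_subset_Icc_self.trans (hU'.out h3 h2)⟩

variable [T2Space M]

/-- The intersection of the domains is open and order connected. Hence any two of its times lie in a
common open interval inside it, where uniqueness of integral curves applies. -/
theorem IsIntegralCurveOnInterval.eqOn (hY : IsSmoothField Y)
    (h : IsIntegralCurveOnInterval ν Y s) (h' : IsIntegralCurveOnInterval ν' Y s') {t₀ : ℝ}
    (h₀ : t₀ ∈ s) (h₀' : t₀ ∈ s') (heq : ν t₀ = ν' t₀) : Set.EqOn ν ν' (s ∩ s') := by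
  intro t ht
  obtain ⟨a, b, h1, h2, h3⟩ := exists_Ioo_subset_of_ordConnected (h.1.inter h'.1)
    (h.2.1.inter h'.2.1) ⟨h₀, h₀'⟩ ht
  exact isMIntegralCurveOn_Ioo_eqOn_of_contMDiff_boundaryless h1
    (ContMDiff.of_le hY (by simp)) (h.2.2.2.mono (h3.trans Set.inter_subset_left))
    (h'.2.2.2.mono (h3.trans Set.inter_subset_right)) heq h2

/-- Through every point there is a maximal integral curve. -/
theorem exists_isMaximalIntegralCurve (hY : IsSmoothField Y) (p : M) :
    ∃ (s : Set ℝ) (ν : ℝ → M), IsMaximalIntegralCurve ν Y s ∧ (0 : ℝ) ∈ s ∧ ν 0 = p := by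
  classical
  -- The maximal domain is the union of the domains of all integral curves starting at `p`. The
  -- diagonal value `η t t` comes from a curve chosen for the time `t`, and uniqueness makes it
  -- agree with every other candidate.
  set S : Set ℝ := ⋃₀ {s' | ∃ ν', IsIntegralCurveOnInterval ν' Y s' ∧ (0 : ℝ) ∈ s' ∧ ν' 0 = p}
    with hS
  have hmem : ∀ t ∈ S, ∃ (s' : Set ℝ) (ν' : ℝ → M),
      (IsIntegralCurveOnInterval ν' Y s' ∧ (0 : ℝ) ∈ s' ∧ ν' 0 = p) ∧ t ∈ s' := by
    rintro t ⟨s', ⟨ν', h⟩, ht⟩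
    exact ⟨s', ν', h, ht⟩
  have : Nonempty M := ⟨p⟩
  choose! σ η hη using hmem
  have heq : ∀ {ν' s'}, IsIntegralCurveOnInterval ν' Y s' → (0 : ℝ) ∈ s' → ν' 0 = p →
      ∀ t ∈ s', η t t = ν' t := by
    intro ν' s' h h0 hp t ht
    have hh := hη t ⟨s', ⟨ν', h, h0, hp⟩, ht⟩
    exact hh.1.1.eqOn hY h hh.1.2.1 h0 (hh.1.2.2.trans hp.symm) ⟨hh.2, ht⟩
  have hsub : ∀ {ν' s'}, IsIntegralCurveOnInterval ν' Y s' → (0 : ℝ) ∈ s' → ν' 0 = p →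
      s' ⊆ S := fun h h0 hp => Set.subset_sUnion_of_mem ⟨_, h, h0, hp⟩
  have h0S : (0 : ℝ) ∈ S := by
    obtain ⟨γ, hγ0, hγ⟩ := exists_isMIntegralCurveAt_of_contMDiffAt_boundaryless (I := 𝓡 2) (t₀ := 0)
      (v := Y) (x₀ := p) (ContMDiff.of_le hY (by simp) p)
    obtain ⟨r, hr, h⟩ := isMIntegralCurveAt_iff'.1 hγ
    have h0 : (0 : ℝ) ∈ Metric.ball (0 : ℝ) r := Metric.mem_ball_self hr
    exact hsub ⟨Metric.isOpen_ball, (convex_ball _ _).ordConnected, ⟨0, h0⟩, h⟩ h0 hγ0 h0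
  have hopen : IsOpen S := isOpen_sUnion fun s' ⟨_, h, _⟩ => h.1
  have hord : S.OrdConnected :=
    (isPreconnected_sUnion (0 : ℝ)
      {s' | ∃ ν', IsIntegralCurveOnInterval ν' Y s' ∧ (0 : ℝ) ∈ s' ∧ ν' 0 = p}
      (fun s' ⟨_, _, h, _⟩ => h) fun s' ⟨_, h, _⟩ => h.2.1.isPreconnected).ordConnected
  have hint : ∀ t ∈ S, IsMIntegralCurveAt (fun t => η t t) Y t := by
    intro t ht
    obtain ⟨⟨h1, h2, h3⟩, h4⟩ := hη t ht
    refine (h1.at h4).congr_of_eventuallyEq ?_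
    filter_upwards [h1.1.mem_nhds h4] with u hu using heq h1 h2 h3 u hu
  refine ⟨S, fun t => η t t, ⟨isIntegralCurveOnInterval_of_at hopen hord ⟨0, h0S⟩ hint, ?_⟩, h0S,
    (hη 0 h0S).1.2.2⟩
  intro ν' s' h' hss' heqon
  refine Set.Subset.antisymm (hsub h' (hss' h0S) ?_) hss'
  exact (heqon h0S).trans (hη 0 h0S).1.2.2

/-- An integral curve that meets a maximal integral curve is contained in it. -/
theorem IsMaximalIntegralCurve.image_subset (hY : IsSmoothField Y)
    (h : IsMaximalIntegralCurve ν Y s) (h' : IsIntegralCurveOnInterval ν' Y s') {t t' : ℝ}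
    (ht : t ∈ s) (ht' : t' ∈ s') (heq : ν t = ν' t') : ν' '' s' ⊆ ν '' s := by
  classical
  -- After shifting time by `d`, the two curves agree at `t`. They therefore glue along `s ∪ s''`,
  -- and maximality forces `s'' ⊆ s`.
  set d := t' - t with hd
  set s'' : Set ℝ := {u | u + d ∈ s'}
  set ν'' : ℝ → M := ν' ∘ (· + d)
  have hcont : Continuous fun u : ℝ => u + d := by fun_prop
  have hts'' : t ∈ s'' := by simpa [s'', hd] using ht'
  have h'' : IsIntegralCurveOnInterval ν'' Y s'' := by
    refine ⟨h'.1.preimage hcont, ⟨fun a ha b hb u hu => ?_⟩, ⟨t, hts''⟩, h'.2.2.2.comp_add d⟩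
    exact h'.2.1.out ha hb ⟨by linarith [hu.1], by linarith [hu.2]⟩
  have hE := h.1.eqOn hY h'' ht hts'' (by simpa [ν'', hd] using heq)
  set κ : ℝ → M := fun u => if u ∈ s then ν u else ν'' u with hκ
  have hκ₁ : Set.EqOn κ ν s := fun u hu => by simp [hκ, hu]
  have hκ₂ : Set.EqOn κ ν'' s'' := fun u hu => by
    by_cases hus : u ∈ s
    · simpa [hκ, hus] using hE ⟨hus, hu⟩
    · simp [hκ, hus]
  have hK : IsIntegralCurveOnInterval κ Y (s ∪ s'') := by
    refine isIntegralCurveOnInterval_of_at (h.1.1.union h''.1) ?_ ⟨t, .inl ht⟩ ?_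
    · exact (IsPreconnected.union t ht hts'' h.1.2.1.isPreconnected
        h''.2.1.isPreconnected).ordConnected
    · rintro u (hu | hu)
      · exact (h.1.at hu).congr_of_eventuallyEq (hκ₁.eventuallyEq_of_mem (h.1.1.mem_nhds hu))
      · exact (h''.at hu).congr_of_eventuallyEq (hκ₂.eventuallyEq_of_mem (h''.1.mem_nhds hu))
  have hmax := h.2 κ (s ∪ s'') hK Set.subset_union_left hκ₁
  rintro _ ⟨u, hu, rfl⟩
  have hu'' : u - d ∈ s'' := by simpa [s''] using hu
  have hus : u - d ∈ s := hmax ▸ Set.mem_union_right s hu''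
  exact ⟨u - d, hus, by simpa [ν''] using hE ⟨hus, hu''⟩⟩

end IntegralCurves

/-! ### Functions constant along integral curves -/

section ConservedQuantities

variable {M : Type*} [TopologicalSpace M] [ChartedSpace Plane M] [IsManifold (𝓡 2) ∞ M]
  {Y : (x : M) → TangentSpace (𝓡 2) x} {ν : ℝ → M} {s : Set ℝ} {f : M → ℝ}

theorem IsMIntegralCurveAt.hasDerivAt_comp {t : ℝ} (h : IsMIntegralCurveAt ν Y t)
    (hf : MDifferentiableAt (𝓡 2) 𝓘(ℝ, ℝ) f (ν t)) :
    HasDerivAt (fun u => f (ν u)) (mvfderiv (𝓡 2) f (ν t) (Y (ν t))) t := by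
  have h1 := HasMFDerivAt.comp t hf.hasMFDerivAt h.hasMFDerivAt
  have h2 : HasFDerivAt (fun u => f (ν u)) (ContinuousLinearMap.toSpanSingleton ℝ
      (mvfderiv (𝓡 2) f (ν t) (Y (ν t)) : ℝ)) t :=
    (hasMFDerivAt_iff_hasFDerivAt.1 h1).congr_fderiv <| ContinuousLinearMap.ext fun a =>
      (mfderiv (𝓡 2) 𝓘(ℝ, ℝ) f (ν t)).map_smul a (Y (ν t))
  exact hasDerivAt_iff_hasFDerivAt.2 h2

theorem IsIntegralCurveOnInterval.comp_eq (h : IsIntegralCurveOnInterval ν Y s)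
    (hf : MDifferentiable (𝓡 2) 𝓘(ℝ, ℝ) f) (h0 : ∀ x, mvfderiv (𝓡 2) f x (Y x) = 0) {t t' : ℝ}
    (ht : t ∈ s) (ht' : t' ∈ s) : f (ν t) = f (ν t') := by
  have hd : ∀ u ∈ s, HasDerivAt (fun u => f (ν u)) 0 u := fun u hu => by
    simpa [h0] using (h.at hu).hasDerivAt_comp (hf (ν u))
  exact h.1.is_const_of_deriv_eq_zero h.2.1.isPreconnected
    (fun u hu => (hd u hu).differentiableAt.differentiableWithinAt) (fun u hu => (hd u hu).deriv)
    ht ht'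

end ConservedQuantities

/-! ### Level sets of functions constant along a curve -/

theorem Plane.eq_zero_of_inner_eq_zero {L : Plane →L[ℝ] ℝ} {w u : Plane} (hL : L ≠ 0) (hw : w ≠ 0)
    (hLw : L w = 0) (hLu : L u = 0) (h : inner ℝ w u = 0) : u = 0 := by
  by_contra hu
  apply hL
  have hli : LinearIndependent ℝ ![w, u] := by
    refine linearIndependent_of_ne_zero_of_inner_eq_zero ?_ ?_
    · intro i
      fin_cases i
      exacts [hw, hu]
    · intro i j hij
      fin_cases i <;> fin_cases j
      exacts [absurd rfl hij, h, (real_inner_comm _ _).trans h, absurd rfl hij]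
  have hb := basisOfLinearIndependentOfCardEqFinrank hli (by simp)
  have hspan := hli.span_eq_top_of_card_eq_finrank (by simp)
  refine ContinuousLinearMap.coe_injective (LinearMap.ext_on_range hspan fun i => ?_)
  fin_cases i
  exacts [hLw, hLu]

/-- On a hyperplane transverse to the kernel of a functional `L` on the plane, `L` is bounded
below. -/
theorem Plane.exists_norm_le_of_inner_eq_zero {L : Plane →L[ℝ] ℝ} {w : Plane} (hL : L ≠ 0)
    (hw : w ≠ 0) (hLw : L w = 0) : ∃ K > 0, ∀ u, inner ℝ w u = 0 → ‖u‖ ≤ K * |L u| := by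
  set A : Plane →L[ℝ] ℝ × ℝ := L.prod (innerSL ℝ w)
  have hker : (A : Plane →ₗ[ℝ] ℝ × ℝ).ker = ⊥ := by
    refine LinearMap.ker_eq_bot'.2 fun u hu => ?_
    obtain ⟨h1, h2⟩ := Prod.ext_iff.1 hu
    exact Plane.eq_zero_of_inner_eq_zero hL hw hLw h1 h2
  obtain ⟨K, hK, hA⟩ := LinearMap.exists_antilipschitzWith _ hker
  refine ⟨K, hK, fun u hu => ?_⟩
  have h1 := hA.le_mul_dist u 0
  have h2 : A u = (L u, 0) := Prod.ext rfl hu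
  simpa [h2] using h1

/-- Only the sign of the difference quotients at `t₀` is used; `g` need not be monotone near `t₀`,
nor differentiable elsewhere. -/
theorem HasDerivAt.exists_lt_lt {g : ℝ → ℝ} {g' t₀ δ : ℝ} (h : HasDerivAt g g' t₀) (hg : 0 < g')
    (hδ : 0 < δ) : ∃ t₁ ∈ Set.Ioo (t₀ - δ) t₀, ∃ t₂ ∈ Set.Ioo t₀ (t₀ + δ),
      g t₁ < g t₀ ∧ g t₀ < g t₂ := by
  have h1 := (hasDerivAt_iff_tendsto_slope.1 h).eventually (lt_mem_nhds hg)
  rw [eventually_nhdsWithin_iff, Metric.eventually_nhds_iff] at h1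
  obtain ⟨r, hr, h1⟩ := h1
  set e := min r δ / 2 with he
  have he0 : 0 < e := by positivity
  have her : e < r := by rw [he]; linarith [min_le_left r δ, lt_min hr hδ]
  have heδ : e < δ := by rw [he]; linarith [min_le_right r δ, lt_min hr hδ]
  refine ⟨t₀ - e, ⟨by linarith, by linarith⟩, t₀ + e, ⟨by linarith, by linarith⟩, ?_, ?_⟩
  · have h2 := h1 (y := t₀ - e) (by simpa [Real.dist_eq, abs_of_pos he0] using her)
      (by simpa using he0.ne')
    rw [slope_def_field] at h2
    by_contra! h3
    exact absurd h2 (not_lt.2 (div_nonpos_of_nonneg_of_nonpos (by linarith) (by linarith)))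
  · have h2 := h1 (y := t₀ + e) (by simpa [Real.dist_eq, abs_of_pos he0] using her)
      (by simpa using he0.ne')
    rw [slope_def_field] at h2
    by_contra! h3
    exact absurd h2 (not_lt.2 (div_nonpos_of_nonpos_of_nonneg (by linarith) (by linarith)))

/-- Near a regular point, the zero set of a function in the plane is contained in any regular curve
of zeros through that point. -/
theorem Plane.eventually_exists_eq_of_eq_zero {f : Plane → ℝ} {L : Plane →L[ℝ] ℝ} {c : ℝ → Plane}
    {w u₀ : Plane} {t₀ : ℝ} {P : ℝ → Prop} (hf : HasStrictFDerivAt f L u₀) (hL : L ≠ 0)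
    (hc : HasDerivAt c w t₀) (hw : w ≠ 0) (hc₀ : c t₀ = u₀)
    (hcont : ∀ᶠ t in 𝓝 t₀, ContinuousAt c t) (hfc : ∀ᶠ t in 𝓝 t₀, f (c t) = 0)
    (hP : ∀ᶠ t in 𝓝 t₀, P t) : ∀ᶠ u in 𝓝 u₀, f u = 0 → ∃ t, P t ∧ c t = u := by
  have hLw : L w = 0 := by
    have h1 : HasDerivAt (f ∘ c) (L w) t₀ :=
      HasFDerivAt.comp_hasDerivAt (l := f) t₀ (hc₀ ▸ hf.hasFDerivAt) hc
    have h2 : HasDerivAt (f ∘ c) 0 t₀ :=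
      (hasDerivAt_const t₀ (0 : ℝ)).congr_of_eventuallyEq hfc
    exact h1.unique h2
  obtain ⟨K, hK, hKb⟩ := Plane.exists_norm_le_of_inner_eq_zero hL hw hLw
  -- The error constant `1 / (2 K)` is half of what the bound `‖u‖ ≤ K |L u|` tolerates. A
  -- difference orthogonal to `w` between two zeros of `f` in `V` then has norm at most half of
  -- itself, so it is zero.
  obtain ⟨V, hV, hVf⟩ := hf.approximates_deriv_on_nhds
    (c := (Real.toNNReal (1 / (2 * K)))) (.inr (by simpa using hK))
  have hV' : ∀ᶠ t in 𝓝 t₀, c t ∈ V := hc.continuousAt.preimage_mem_nhds (hc₀ ▸ hV)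
  obtain ⟨δ, hδ, hball⟩ :=
    Metric.eventually_nhds_iff_ball.1 (hV'.and (hcont.and (hfc.and hP)))
  have hg : HasDerivAt (fun t => inner ℝ w (c t)) (inner ℝ w w) t₀ :=
    HasFDerivAt.comp_hasDerivAt (l := fun u => inner ℝ w u) t₀ (innerSL ℝ w).hasFDerivAt hc
  -- The `w`-component of the curve crosses that of `u₀`. For `u` near `u₀` the intermediate value
  -- theorem gives a time at which `c t - u` is orthogonal to `w`.
  obtain ⟨t₁, ht₁, t₂, ht₂, hl, hr⟩ := hg.exists_lt_lt (real_inner_self_pos.2 hw) hδ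
  rw [hc₀] at hl hr
  have hin : ∀ t ∈ Set.Icc t₁ t₂, t ∈ Metric.ball t₀ δ := fun t ht => by
    rw [Real.ball_eq_Ioo]
    exact ⟨by linarith [ht.1, ht₁.1], by linarith [ht.2, ht₂.2]⟩
  have hinner : ContinuousAt (fun u : Plane => inner ℝ w u) u₀ := by fun_prop
  filter_upwards [hV, hinner.eventually (lt_mem_nhds hl), hinner.eventually (gt_mem_nhds hr)]
    with u huV hu₁ hu₂ hfu
  obtain ⟨t, ht, htu⟩ := intermediate_value_Icc (f := fun t => inner ℝ w (c t))
    (by linarith [ht₁.2, ht₂.1])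
    (fun t ht => (ContinuousAt.inner continuousAt_const
      (hball t (hin t ht)).2.1).continuousWithinAt) ⟨hu₁.le, hu₂.le⟩
  obtain ⟨h1, -, h2, h3⟩ := hball t (hin t ht)
  refine ⟨t, h3, sub_eq_zero.1 (norm_le_zero_iff.1 ?_)⟩
  have h4 := hVf _ h1 _ huV
  rw [h2, hfu, sub_zero, zero_sub, norm_neg, Real.norm_eq_abs,
    Real.coe_toNNReal _ (by positivity)] at h4
  have h5 := hKb (c t - u) (by rw [inner_sub_right]; exact sub_eq_zero.2 htu)
  have h6 : K * |L (c t - u)| ≤ K * (1 / (2 * K) * ‖c t - u‖) :=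
    mul_le_mul_of_nonneg_left h4 hK.le
  have h7 : K * (1 / (2 * K) * ‖c t - u‖) = ‖c t - u‖ / 2 := by field_simp
  linarith

/-! ### Closed integral curves in regular level sets on a surface -/

section LevelSets

variable {M : Type*} [TopologicalSpace M] [ChartedSpace Plane M] [IsManifold (𝓡 2) ∞ M]
  {Y : (x : M) → TangentSpace (𝓡 2) x} {ν : ℝ → M} {s : Set ℝ} {f : M → ℝ}

/-- Near a regular point, the zero set of `f` is contained in any regular integral curve through
that point along which `f` vanishes. -/
theorem IsMIntegralCurveAt.eventually_exists_eq {η : ℝ → M} {t₀ : ℝ}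
    (hη : IsMIntegralCurveAt η Y t₀) (hY : Y (η t₀) ≠ 0)
    (hf : ContMDiffAt (𝓡 2) 𝓘(ℝ, ℝ) ∞ f (η t₀)) (hdf : mvfderiv (𝓡 2) f (η t₀) ≠ 0)
    (hfη : ∀ᶠ t in 𝓝 t₀, f (η t) = 0) {P : ℝ → Prop} (hP : ∀ᶠ t in 𝓝 t₀, P t) :
    ∀ᶠ y in 𝓝 (η t₀), f y = 0 → ∃ t, P t ∧ η t = y := by
  set q := η t₀ with hq
  set φ := extChartAt (𝓡 2) q with hφ
  have hsrc : ∀ᶠ t in 𝓝 t₀, η t ∈ φ.source :=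
    hη.continuousAt.preimage_mem_nhds (extChartAt_source_mem_nhds (I := 𝓡 2) q)
  have hsm : ContDiffAt ℝ ∞ (f ∘ φ.symm) (φ q) := by
    have h := (contMDiffAt_iff.1 hf).2
    simp only [extChartAt_model_space_eq_id, ModelWithCorners.range_eq_univ,
      contDiffWithinAt_univ] at h
    exact h
  have hstrict := hsm.hasStrictFDerivAt (by simp)
  set L := fderiv ℝ (f ∘ φ.symm) (φ q)
  have hchart : MDifferentiableAt (𝓡 2) 𝓘(ℝ, Plane) φ q :=
    mdifferentiableAt_extChartAt (mem_chart_source _ q)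
  have hL : L ≠ 0 := by
    intro h0
    apply hdf
    ext v
    have e : f =ᶠ[𝓝 q] fun y => (f ∘ φ.symm) (φ y) := by
      filter_upwards [extChartAt_source_mem_nhds (I := 𝓡 2) q] with y hy
      exact congrArg f (φ.left_inv hy).symm
    rw [mvfderiv_congr e, mvfderiv_comp_of_hasFDerivAt hchart hstrict.hasFDerivAt, h0]
    rfl
  have hder := hη.eventually_hasDerivAt
  have hc := hder.self_of_nhds
  -- In the chart centred at `q` the velocity at `t₀` is `Y q` itself, because the coordinate change
  -- from a chart to itself is the identity.
  replace hc := hc.congr_deriv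
    (tangentCoordChange_self (I := 𝓡 2) (v := Y q) (mem_extChartAt_source q))
  have h := Plane.eventually_exists_eq_of_eq_zero (P := fun t => P t ∧ η t ∈ φ.source) hstrict hL hc
    hY rfl (hder.mono fun t ht => ht.continuousAt) (by
      filter_upwards [hfη, hsrc] with t h1 h2 using (congrArg f (φ.left_inv h2)).trans h1)
    (hP.and hsrc)
  have h' := (continuousAt_extChartAt (I := 𝓡 2) q).eventually h
  filter_upwards [h', extChartAt_source_mem_nhds (I := 𝓡 2) q] with y hy hys hfy
  obtain ⟨t, ⟨h1, h2⟩, h3⟩ := hy ((congrArg f (φ.left_inv hys)).trans hfy)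
  exact ⟨t, h1, φ.injOn h2 hys h3⟩

variable [T2Space M] [RiemannianBundle (fun x : M => TangentSpace (𝓡 2) x)]
  [IsContMDiffRiemannianBundle (𝓡 2) ∞ Plane (fun x : M => TangentSpace (𝓡 2) x)]

/-- A maximal integral curve of constant nonzero speed in a regular level set is closed. -/
theorem IsMaximalIntegralCurve.isClosed_image (hY : IsSmoothField Y)
    (h : IsMaximalIntegralCurve ν Y s) (hf : ContMDiff (𝓡 2) 𝓘(ℝ, ℝ) ∞ f)
    (hfY : ∀ x, mvfderiv (𝓡 2) f x (Y x) = 0)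
    (hYY : ∀ x, mvfderiv (𝓡 2) (fun y => ‖Y y‖ ^ 2) x (Y x) = 0)
    (hreg : ∀ x, f x = 0 → Y x ≠ 0 → mvfderiv (𝓡 2) f x ≠ 0) {t₀ : ℝ} (ht₀ : t₀ ∈ s)
    (hf₀ : f (ν t₀) = 0) (hY₀ : Y (ν t₀) ≠ 0) : IsClosed (ν '' s) := by
  have hfd : MDifferentiable (𝓡 2) 𝓘(ℝ, ℝ) f := hf.mdifferentiable (by simp)
  have hN := contMDiff_of_smoothFunNear (smoothFunNear_norm_sq hY)
  refine isClosed_of_closure_subset fun q hq => ?_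
  have hfq : f q = 0 := by
    have hcl : IsClosed {y | f y = 0} := isClosed_eq hf.continuous continuous_const
    refine closure_minimal ?_ hcl hq
    rintro _ ⟨t, ht, rfl⟩
    exact (h.1.comp_eq hfd hfY ht ht₀).trans hf₀
  -- Constancy of the speed along the curve passes to limit points, so the curve cannot accumulate
  -- at a zero of `Y`.
  have hYq : Y q ≠ 0 := by
    have hcl : IsClosed {y | ‖Y y‖ ^ 2 = ‖Y (ν t₀)‖ ^ 2} :=
      isClosed_eq hN.continuous continuous_const
    have h1 : ‖Y q‖ ^ 2 = ‖Y (ν t₀)‖ ^ 2 := by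
      refine closure_minimal ?_ hcl hq
      rintro _ ⟨t, ht, rfl⟩
      exact h.1.comp_eq (hN.mdifferentiable (by simp)) hYY ht ht₀
    intro h0
    rw [h0, norm_zero] at h1
    exact hY₀ (norm_eq_zero.1 (pow_eq_zero_iff two_ne_zero |>.1 (by linarith)))
  obtain ⟨s', η, hη, h0, rfl⟩ := exists_isMaximalIntegralCurve hY q
  have hfη : ∀ t ∈ s', f (η t) = 0 := fun t ht => (hη.1.comp_eq hfd hfY ht h0).trans hfq
  have hs' : s' ∈ 𝓝 (0 : ℝ) := hη.1.1.mem_nhds h0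
  -- Near `q` every zero of `f` lies on the integral curve `η` through `q`. The given curve consists
  -- of zeros and comes arbitrarily close to `q`, so it meets `η` and therefore contains it.
  have hev := (hη.1.at h0).eventually_exists_eq hYq (hf _) (hreg _ hfq hYq)
    (Filter.mem_of_superset hs' hfη) (P := fun t => t ∈ s') hs'
  obtain ⟨y, hy, ⟨t, ht, rfl⟩⟩ := mem_closure_iff_nhds.1 hq _ hev
  obtain ⟨t', ht', heq⟩ := hy ((h.1.comp_eq hfd hfY ht ht₀).trans hf₀)
  exact h.image_subset hY hη.1 ht ht' heq.symm ⟨0, h0, rfl⟩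

end LevelSets

/-! ### Auxiliary identities for the final assembly -/

section Summary

variable {M : Type*} [TopologicalSpace M] [ChartedSpace Plane M] [IsManifold (𝓡 2) ∞ M]
  [RiemannianBundle (fun x : M => TangentSpace (𝓡 2) x)]
  [IsContMDiffRiemannianBundle (𝓡 2) ∞ Plane (fun x : M => TangentSpace (𝓡 2) x)]
  {o : (x : M) → Orientation ℝ (TangentSpace (𝓡 2) x) (Fin 2)}
  {Y : (x : M) → TangentSpace (𝓡 2) x} {ε τ σ : ℝ} {R F : M → ℝ}

theorem inner_cplx_right_self (x : M) (v : TangentSpace (𝓡 2) x) :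
    inner ℝ v (cplx o x v) = 0 := by
  rw [real_inner_comm, inner_cplx_self]

theorem inner_cplx_cplx_right (x : M) (v : TangentSpace (𝓡 2) x) :
    inner ℝ v (cplx o x (cplx o x v)) = -‖v‖ ^ 2 := by
  rw [cplx_cplx, inner_neg_right, real_inner_self_eq_norm_sq]

/-- The functions `e^{-2aμ} (R + a F)`, where `a ^ 2 = ε`, are constant on the universal cover. -/
theorem exists_exp_mul_add_eq_const (mR : MDifferentiable (𝓡 2) 𝓘(ℝ, ℝ) R)
    (mF : MDifferentiable (𝓡 2) 𝓘(ℝ, ℝ) F)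
    (dR : ∀ x v, mvfderiv (𝓡 2) R x v = 2 * ε * F x * inner ℝ (Y x) (cplx o x v))
    (dF : ∀ x v, mvfderiv (𝓡 2) F x v = 2 * R x * inner ℝ (Y x) (cplx o x v))
    {N : Type*} [TopologicalSpace N] [ChartedSpace Plane N] {pr : N → M} {μ : N → ℝ}
    (hpr : IsUniversalCover pr) (hμ : IsMomentMapAlong o pr Y μ) {a : ℂ} (ha : a ^ 2 = (ε : ℂ)) :
    ∃ c : ℂ, ∀ x, Complex.exp (-(2 * a) * μ x) * ((R (pr x) : ℂ) + a * (F (pr x) : ℂ)) = c := by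
  have hφ : Differentiable ℝ (fun p : ℝ × ℝ => (p.1 : ℂ) + a * (p.2 : ℂ)) := by
    have : Differentiable ℝ (fun t : ℝ => (t : ℂ)) := Complex.ofRealCLM.differentiable
    fun_prop
  refine exists_exp_mul_eq_const hpr hμ (G := fun x => (R x : ℂ) + a * (F x : ℂ)) (fun x => ?_)
    fun x v => ?_
  · exact (hφ.differentiableAt.mdifferentiableAt (x := (R x, F x))).comp x
      ((mR x).prodMk_space (mF x))
  · refine mvfderiv_comp₂ (φ := fun p : ℝ × ℝ => (p.1 : ℂ) + a * (p.2 : ℂ)) (mR x) (mF x)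
      hφ.differentiableAt ?_
    have hl : ∀ a b : ℝ, HasDerivAt (fun t : ℝ => ((a + t • b : ℝ) : ℂ)) (b : ℂ) 0 := fun a b => by
      have : HasDerivAt (fun t : ℝ => a + t • b) b 0 := by
        simpa using ((hasDerivAt_id (0 : ℝ)).smul_const b).const_add a
      exact this.ofReal_comp
    convert! ((hl (R x) (mvfderiv (𝓡 2) R x v)).add
      ((hl (F x) (mvfderiv (𝓡 2) F x v)).const_mul a)) using 1
    rw [dR, dF]
    push_cast
    linear_combination (2 * (F x : ℂ) * (inner ℝ (Y x) (cplx o x v) : ℝ)) * ha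

theorem mvfderiv_const_mul {x : M} (a : ℝ) {f : M → ℝ}
    (hf : MDifferentiableAt (𝓡 2) 𝓘(ℝ, ℝ) f x) (v : TangentSpace (𝓡 2) x) :
    mvfderiv (𝓡 2) (fun y => a * f y) x v = a * mvfderiv (𝓡 2) f x v := by
  rw [mvfderiv_comp_of_hasFDerivAt (φ := fun t => a * t) hf
    ((hasDerivAt_id _).const_mul a).hasFDerivAt]
  simp [mul_comm]

theorem eq_neg_sqrt_or_eq_sqrt_iff {a : ℝ} (hσ : 0 ≤ σ) : (a = -√σ ∨ a = √σ) ↔ a ^ 2 = σ := by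
  rw [or_comm, ← sq_eq_sq_iff_eq_or_eq_neg, Real.sq_sqrt hσ]

end Summary

/-! ### The theorem on solutions of the real vortex equations -/

theorem mainTheorem4 {M : Type*} [TopologicalSpace M] [T2Space M] [SecondCountableTopology M]
    [ConnectedSpace M] [ChartedSpace Plane M] [IsManifold (𝓡 2) ∞ M]
    [RiemannianBundle (fun x : M => TangentSpace (𝓡 2) x)]
    [IsContMDiffRiemannianBundle (𝓡 2) ∞ Plane (fun x : M => TangentSpace (𝓡 2) x)]
    (o : (x : M) → Orientation ℝ (TangentSpace (𝓡 2) x) (Fin 2)) (ho : IsSurfaceOrientation o)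
    (ε : ℝ) (hε : ε = 1 ∨ ε = -1)
    (Y : (x : M) → TangentSpace (𝓡 2) x) (hY : SolvesRealVortex ε Y)
    (τ : ℝ) (hτ : ∀ x : M, τ = scalarCurvature x + 4 * ε * ‖Y x‖ ^ 2)
    (R F : M → ℝ) (hR : R = scalarCurvature) (hF : F = faraday o Y)
    (lam : ℂ) (hlam : lam = if ε = 1 then 1 else Complex.I) :
    ContMDiff (𝓡 2) 𝓘(ℝ, ℝ) ∞ R ∧ ContMDiff (𝓡 2) 𝓘(ℝ, ℝ) ∞ F ∧
    ∃ σ : ℝ,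
      -- constancy of `σ` on `M`
      (∀ x, R x ^ 2 - ε * F x ^ 2 = σ) ∧
      -- constancy of `e^{∓2λμ} (R ± λF)` on the universal cover
      (∀ (N : Type*) [TopologicalSpace N] [ChartedSpace Plane N] (pr : N → M) (μ : N → ℝ),
        IsUniversalCover pr → IsMomentMapAlong o pr Y μ →
          (∃ c : ℂ, ∀ x : N,
            Complex.exp (-2 * lam * (μ x : ℂ)) * ((R (pr x) : ℂ) + lam * (F (pr x) : ℂ)) = c) ∧
          (∃ c : ℂ, ∀ x : N,
            Complex.exp (2 * lam * (μ x : ℂ)) * ((R (pr x) : ℂ) - lam * (F (pr x) : ℂ)) = c)) ∧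
      -- descent of the moment map to `M` and signs of `R ± F`
      (ε = 1 →
        (((∃ x, R x + F x ≠ 0) ∨ (∃ x, R x - F x ≠ 0)) →
          ∀ (N : Type*) [TopologicalSpace N] [ChartedSpace Plane N] (pr : N → M) (μ : N → ℝ),
            IsUniversalCover pr → IsMomentMapAlong o pr Y μ →
              ∃ m : M → ℝ, IsMomentMap o Y m ∧ ∀ x : N, μ x = m (pr x)) ∧
        ((∃ x, R x + F x ≠ 0) → HasDefiniteSign (fun x => R x + F x)) ∧
        ((∃ x, R x - F x ≠ 0) → HasDefiniteSign (fun x => R x - F x))) ∧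
      -- bounds for `ε = 1`
      (ε = 1 →
        (∀ x, R x ≤ τ ∧ (R x = τ ↔ Y x = 0)) ∧
        (∀ x, σ ≤ R x ^ 2 ∧ (R x ^ 2 = σ ↔ F x = 0)) ∧
        (0 < σ → HasDefiniteSign R ∧
          ((∀ x, √σ ≤ R x ∧ R x ≤ τ) ∨ ((∀ x, R x ≤ min τ (-√σ)) ∧ min τ (-√σ) < 0))) ∧
        (σ < 0 → HasDefiniteSign F)) ∧
      -- bounds for `ε = -1`
      (ε = -1 →
        0 ≤ σ ∧
        (∀ x, -√σ ≤ R x ∧ R x ≤ √σ ∧ ((R x = -√σ ∨ R x = √σ) ↔ F x = 0)) ∧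
        (∀ x, -√σ ≤ F x ∧ F x ≤ √σ ∧ ((F x = -√σ ∨ F x = √σ) ↔ R x = 0)) ∧
        (∀ x, τ ≤ R x ∧ (R x = τ ↔ Y x = 0))) ∧
      -- critical points
      (∀ x, mvfderiv (𝓡 2) R x = 0 →
        (F x = 0 ∨ Y x = 0) ∧ (Y x = 0 → mvfderiv (𝓡 2) F x = 0)) ∧
      (∀ x, mvfderiv (𝓡 2) F x = 0 →
        (R x = 0 ∨ Y x = 0) ∧ (Y x = 0 → mvfderiv (𝓡 2) R x = 0)) ∧
      -- Laplacian identities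
      (∀ x, laplacian R x + 2 * R x ^ 2 = τ * R x + σ) ∧
      (∀ x, laplacian F x = τ * F x - 2 * R x * F x) ∧
      -- the zero set of `F` away from the zeros of `Y`
      (σ ≠ 0 → ∃ C : Set (Set M),
        {p : M | Y p ≠ 0 ∧ F p = 0} = ⋃₀ C ∧
        ∀ c ∈ C, IsClosed c ∧ ∃ (s : Set ℝ) (ν : ℝ → M),
          IsMaximalIntegralCurve ν Y s ∧ IsGeodesicOn ν s ∧ c = ν '' s) := by
  have hYs := hY.smooth
  have hk := hY.killing
  have sR : ∀ x, SmoothFunNear R x := fun x => hR ▸ smoothFunNear_scalarCurvature hτ hYs x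
  have sF : ∀ x, SmoothFunNear F x := fun x => hF ▸ smoothFunNear_faraday ho hYs hk x
  have cR := contMDiff_of_smoothFunNear sR
  have cF := contMDiff_of_smoothFunNear sF
  have mR : MDifferentiable (𝓡 2) 𝓘(ℝ, ℝ) R := cR.mdifferentiable (by simp)
  have mF : MDifferentiable (𝓡 2) 𝓘(ℝ, ℝ) F := cF.mdifferentiable (by simp)
  have dR : ∀ x v, mvfderiv (𝓡 2) R x v = 2 * ε * F x * inner ℝ (Y x) (cplx o x v) :=
    fun x v => by rw [hR, hF, mvfderiv_scalarCurvature (o := o) hτ hYs hk]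
  have dF : ∀ x v, mvfderiv (𝓡 2) F x v = 2 * R x * inner ℝ (Y x) (cplx o x v) :=
    fun x v => by rw [hR, hF, mvfderiv_faraday ho hYs hk]
  have hτ' : ∀ x, R x = τ - 4 * ε * ‖Y x‖ ^ 2 := fun x => by rw [hR]; linarith [hτ x]
  have hε0 : ε ≠ 0 := by rcases hε with rfl | rfl <;> norm_num
  have hlam2 : lam ^ 2 = (ε : ℂ) := by
    rcases hε with rfl | rfl
    · simp [hlam]
    · rw [hlam, if_neg (by norm_num)]
      simp
  obtain ⟨σ, hσ⟩ := exists_sq_sub_sq_eq_const mR mF dR dF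
  refine ⟨cR, cF, σ, hσ, ?_, ?_, ?_, ?_, ?_, ?_, ?_, ?_, ?_⟩
  · intro N _ _ pr μ hpr hμ
    have h1 := exists_exp_mul_add_eq_const mR mF dR dF hpr hμ hlam2
    -- The system depends only on `λ² = ε`, so the second function is the first one for the root
    -- `-λ`.
    have h2 := exists_exp_mul_add_eq_const mR mF dR dF hpr hμ (a := -lam) (by rw [neg_sq, hlam2])
    simpa [← sub_eq_add_neg] using And.intro h1 h2
  · rintro rfl
    have mP : MDifferentiable (𝓡 2) 𝓘(ℝ, ℝ) fun x => R x + F x := fun x => (mR x).add (mF x)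
    have mQ : MDifferentiable (𝓡 2) 𝓘(ℝ, ℝ) fun x => R x - F x := fun x => (mR x).sub (mF x)
    have dP : ∀ x v, mvfderiv (𝓡 2) (fun x => R x + F x) x v =
        2 * (R x + F x) * inner ℝ (Y x) (cplx o x v) := fun x v => by
      rw [mvfderiv_fun_add (mR x) (mF x), _root_.add_apply, dR, dF]
      ring
    have dQ : ∀ x v, mvfderiv (𝓡 2) (fun x => R x - F x) x v =
        -2 * (R x - F x) * inner ℝ (Y x) (cplx o x v) := fun x v => by
      rw [mvfderiv_fun_sub (mR x) (mF x), _root_.sub_apply, dR, dF]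
      ring
    have hP := hasDefiniteSign_of_mvfderiv_eq hYs mP dP
    have hQ := hasDefiniteSign_of_mvfderiv_eq hYs mQ dQ
    refine ⟨?_, hP, hQ⟩
    intro hne N _ _ pr μ hpr hμ
    have := hpr.simplyConnected
    rcases hne with h | h
    · obtain ⟨c, hc⟩ := exists_exp_mul_add_eq_const mR mF dR dF hpr hμ (a := 1) (by simp)
      -- For `ε = 1` the conserved complex quantity is real, so its real part serves as the real
      -- constant.
      refine exists_isMomentMap_of_hasDefiniteSign (s := 2) (c := c.re) two_ne_zero (cR.add cF) dP
        (hP h) fun x => ?_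
      rw [← hc x, ← Complex.ofReal_re (Real.exp (-2 * μ x) * _)]
      congr 1
      push_cast
      simp
    · obtain ⟨c, hc⟩ := exists_exp_mul_add_eq_const mR mF dR dF hpr hμ (a := -1) (by simp)
      refine exists_isMomentMap_of_hasDefiniteSign (s := -2) (c := c.re) (by norm_num)
        (cR.sub cF) dQ (hQ h) fun x => ?_
      rw [← hc x, ← Complex.ofReal_re (Real.exp (- -2 * μ x) * _)]
      congr 1
      push_cast
      simp [sub_eq_add_neg]
  · rintro rfl
    have hRF : ∀ x, R x ^ 2 = σ + F x ^ 2 := fun x => by linarith [hσ x]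
    refine ⟨fun x => ⟨?_, ?_⟩, fun x => ⟨?_, ?_⟩, fun hpos => ?_, fun hneg => ?_⟩
    · nlinarith [hτ' x, sq_nonneg ‖Y x‖]
    · rw [hτ' x, sub_eq_self]
      simp
    · nlinarith [hRF x, sq_nonneg (F x)]
    · rw [hRF x, add_eq_left, sq_eq_zero_iff]
    · have hsgn : HasDefiniteSign R := hasDefiniteSign_of_ne_zero cR.continuous fun x hx => by
        have := hRF x
        rw [hx] at this
        nlinarith [sq_nonneg (F x)]
      refine ⟨hsgn, ?_⟩
      have hRτ : ∀ x, R x ≤ τ := fun x => by nlinarith [hτ' x, sq_nonneg ‖Y x‖]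
      rcases hsgn with h | h
      · exact .inl fun x => ⟨Real.sqrt_le_iff.2 ⟨(h x).le, by nlinarith [hRF x, sq_nonneg (F x)]⟩,
          hRτ x⟩
      · refine .inr ⟨fun x => le_min (hRτ x) (le_neg_of_le_neg ?_), min_lt_of_right_lt ?_⟩
        · exact Real.sqrt_le_iff.2 ⟨by linarith [h x], by nlinarith [hRF x, sq_nonneg (F x)]⟩
        · exact neg_lt_zero.2 (Real.sqrt_pos.2 hpos)
    · refine hasDefiniteSign_of_ne_zero cF.continuous fun x hx => ?_
      have := hRF x
      rw [hx] at this
      nlinarith [sq_nonneg (R x)]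
  · rintro rfl
    have hRF : ∀ x, R x ^ 2 + F x ^ 2 = σ := fun x => by linarith [hσ x]
    have hσ0 : 0 ≤ σ := by
      rw [← hRF (Classical.arbitrary M)]
      positivity
    have hR2 : ∀ x, R x ^ 2 ≤ σ := fun x => by nlinarith [hRF x, sq_nonneg (F x)]
    have hF2 : ∀ x, F x ^ 2 ≤ σ := fun x => by nlinarith [hRF x, sq_nonneg (R x)]
    refine ⟨hσ0, fun x => ⟨?_, ?_, ?_⟩, fun x => ⟨?_, ?_, ?_⟩, fun x => ⟨?_, ?_⟩⟩
    · exact (abs_le.1 (Real.abs_le_sqrt (hR2 x))).1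
    · exact (abs_le.1 (Real.abs_le_sqrt (hR2 x))).2
    · rw [eq_neg_sqrt_or_eq_sqrt_iff hσ0, ← hRF x, left_eq_add, sq_eq_zero_iff]
    · exact (abs_le.1 (Real.abs_le_sqrt (hF2 x))).1
    · exact (abs_le.1 (Real.abs_le_sqrt (hF2 x))).2
    · rw [eq_neg_sqrt_or_eq_sqrt_iff hσ0, ← hRF x, right_eq_add, sq_eq_zero_iff]
    · nlinarith [hτ' x, sq_nonneg ‖Y x‖]
    · rw [hτ' x, sub_eq_self]
      simp
  · intro x hx
    refine ⟨?_, fun h => ?_⟩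
    -- The vector `J Y` is the right test vector because `h(Y, J J Y) = -|Y|²`.
    · have h := dR x (cplx o x (Y x))
      rw [hx, inner_cplx_cplx_right] at h
      simpa [hε0] using h
    · ext v
      rw [dF, h]
      simp
  · intro x hx
    refine ⟨?_, fun h => ?_⟩
    · have h := dF x (cplx o x (Y x))
      rw [hx, inner_cplx_cplx_right] at h
      simpa using h
    · ext v
      rw [dR, h]
      simp
  · intro x
    have hc : ∀ v, mvfderiv (𝓡 2) (fun y => 2 * ε * F y) x v = 2 * ε * mvfderiv (𝓡 2) F x v :=
      mvfderiv_const_mul (2 * ε) (mF x)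
    rw [laplacian_eq_of_killing ho hYs hk ((SmoothFunNear.const (2 * ε) x).mul (sF x)) dR, hc, dF,
      inner_cplx_cplx_right, ← hF, ← hσ x, hτ x, ← hR]
    ring
  · intro x
    have hc : ∀ v, mvfderiv (𝓡 2) (fun y => 2 * R y) x v = 2 * mvfderiv (𝓡 2) R x v :=
      mvfderiv_const_mul 2 (mR x)
    rw [laplacian_eq_of_killing ho hYs hk ((SmoothFunNear.const 2 x).mul (sR x)) dF, hc, dR,
      inner_cplx_cplx_right, ← hF, hτ x, ← hR]
    ring
  · intro hσ0
    have hFY : ∀ x, mvfderiv (𝓡 2) F x (Y x) = 0 := fun x => by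
      rw [dF, inner_cplx_right_self, mul_zero]
    have hYY : ∀ x, mvfderiv (𝓡 2) (fun y => ‖Y y‖ ^ 2) x (Y x) = 0 := fun x => by
      rw [mvfderiv_norm_sq_of_killing (o := o) hYs hk, inner_cplx_right_self, mul_zero]
    -- If `dF` vanished here, evaluation on `J Y` would give `R x = 0`. Together with `F x = 0` this
    -- contradicts `σ ≠ 0`.
    have hreg : ∀ x, F x = 0 → Y x ≠ 0 → mvfderiv (𝓡 2) F x ≠ 0 := by
      intro x hFx hYx h0
      have h := dF x (cplx o x (Y x))
      rw [h0, inner_cplx_cplx_right] at h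
      have hRx : R x = 0 := by simpa [hYx] using h
      exact hσ0 (by rw [← hσ x, hRx, hFx]; ring)
    -- Membership is required at a single time only, since `F` and `|Y|²` are constant along the
    -- curve.
    refine ⟨{c | ∃ (s : Set ℝ) (ν : ℝ → M), IsMaximalIntegralCurve ν Y s ∧
      (∃ t ∈ s, Y (ν t) ≠ 0 ∧ F (ν t) = 0) ∧ c = ν '' s}, ?_, ?_⟩
    · ext p
      constructor
      · rintro hp
        obtain ⟨s, ν, h, h0, rfl⟩ := exists_isMaximalIntegralCurve hYs p
        exact ⟨_, ⟨s, ν, h, ⟨0, h0, hp⟩, rfl⟩, ⟨0, h0, rfl⟩⟩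
      · rintro ⟨_, ⟨s, ν, h, ⟨t₀, ht₀, hY₀, hF₀⟩, rfl⟩, ⟨t, ht, rfl⟩⟩
        refine ⟨fun h0 => hY₀ ?_, (h.1.comp_eq mF hFY ht ht₀).trans hF₀⟩
        have h1 := h.1.comp_eq ((contMDiff_of_smoothFunNear
          (smoothFunNear_norm_sq hYs)).mdifferentiable (by simp)) hYY ht ht₀
        rw [h0, norm_zero, zero_pow two_ne_zero, eq_comm] at h1
        exact norm_eq_zero.1 (pow_eq_zero_iff two_ne_zero |>.1 h1)
    · rintro _ ⟨s, ν, h, ⟨t₀, ht₀, hY₀, hF₀⟩, rfl⟩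
      refine ⟨h.isClosed_image hYs cF hFY hYY hreg ht₀ hF₀ hY₀, s, ν, h, fun t ht => ?_, rfl⟩
      -- `Y` itself extends the velocity, and `D_Y Y` is a multiple of `F J Y`, which vanishes along
      -- the curve.
      refine ⟨Y, hYs (ν t), h.1.at ht, ?_⟩
      rw [leviCivita_eq_of_killing (o := o) (hYs.near _).diff (hk _), ← hF,
        (h.1.comp_eq mF hFY ht ht₀).trans hF₀]
      simp
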